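/- Let $S=\mathbb R/2\pi\mathbb Z$. For $f:S\to\mathbb R$ let $F_{r,a}(x)=x+2\pi r+a f(x) \pmod{2\pi}$, $r,a\in\mathbb R$. For a circle map $g$ let $N(g)\in\{0,1,2,\dots,\infty\}$ be the number of attracting periodic trajectories of $g$ (those through a periodic point of minimal period $q$ that is an asymptotically stable fixed point of $g^q$), and let $\rho(F_{r,a})\in\mathbb R$ be the rotation number of the lift $x\mapsto x+2\pi r+af(x)$ (measured in units of full turns), which is increasing for small $|a|$ when $f\in C^1$. Put $$B(F,\rho_0)=\limsup_{a_1\to0+}\ \sup_{\rho(F_{r,a})=\rho_0,\ |a|<a_1}N(F_{r,a}).$$ For a space $X$ of real functions on $S$ let $\mathcal{IC}_N(X)$ be the set of $f\in X$ with $B(F,\rho)\le N$ for all $\rho\in\mathbb R$, let $\mathcal{IC}_{\rm fin}(X)=\bigcup_{N\ge1}\mathcal{IC}_N(X)$ and $\mathcal{IC}_\infty(X)=X\setminus\mathcal{IC}_{\rm fin}(X)$. Let $\mathcal{IC}^e_N(X)$ be the set of $f\in X$ for which there is $Q\in\mathbb N$ such that $B(F,p/q)\le N$ for all fractions $p/q$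 in lowest terms with $p \ge 0$, $q\ge1$ and $q\ge Q$. For an integer $k\ge2$ let $C^k(S)$ be the Banach space of real $k$ times continuously differentiable functions on $S$ with norm $\max_{j\le k}\sup|f^{(j)}|$. For $\delta>0$ let $C^\omega_\delta(S)$ be the real Banach space of $2\pi$-periodic functions, real on $\mathbb R$, that are holomorphic on $|\mathrm{Im}\, z|<\delta$ and continuous on $|\mathrm{Im}\, z|\le\delta$, with norm $\sup_{|\mathrm{Im}\, z|<\delta}|f(z)|$. A cube measure on a separable Banach space $X$ is the image of the product of Lebesgue measures on $[0,1]^{\mathbb N}$ under a map $(t_n)\mapsto x_0+\sum_n t_nx_n$, where $x_0,x_1,\ldots\in X$, the vectors $x_1,x_2,\dots$ are linearly independent with dense linear span, and $\sum_n\|x_n\|<\infty$. A set is cube null if it has measure zero for every cube measure on $X$, and cube prevalent if its complement is cube null. Theorem. (1) For every integer $k\ge 2$, the set $\mathcal{IC}_\infty(C^k(S))$ is not cube prevalent; moreover, there is a cube measure on $C^k(S)$ for which it has measure zero. (2) For every $\delta>0$, neither $\mathcal{IC}^e_1(C^\omega_\delta(S))$ nor $\mathcal{IC}_{\rm fin}(C^\omega_\delta(S))$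 is cube prevalent; moreover, there is a cube measure on $C^\omega_\delta(S)$ for which both sets have measure zero. -/

import Mathlib

open MeasureTheory Filter Topology Function
open scoped BoundedContinuousFunction NNReal

noncomputable section

namespace CircleFamily

/-! ## Circle maps, attracting periodic trajectories, infinitesimal cyclicity -/

/-- The circle `ℝ / 2πℤ`. -/
abbrev Circle2Pi : Type := AddCircle (2 * Real.pi)

/-- The circle map `F_{r,a} : x ↦ x + 2πr + a f(x) (mod 2π)`. -/
def circleMap (f : Circle2Pi → ℝ) (r a : ℝ) (θ : Circle2Pi) : Circle2Pi :=
  θ + ((2 * Real.pi * r + a * f θ : ℝ) : Circle2Pi)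

/-- `x` is an attracting periodic point of `g`: it is periodic, and it is an asymptotically stable
fixed point (Lyapunov stable and attracting a neighbourhood) of `g^q`, `q` its minimal period. -/
def IsAttractingPeriodicPt {S : Type*} [TopologicalSpace S] (g : S → S) (x : S) : Prop :=
  x ∈ periodicPts g ∧
  (∀ U ∈ 𝓝 x, ∃ V ∈ 𝓝 x, ∀ y ∈ V, ∀ n : ℕ, (g^[minimalPeriod g x])^[n] y ∈ U) ∧
  (∃ V ∈ 𝓝 x, ∀ y ∈ V, Tendsto (fun n : ℕ => (g^[minimalPeriod g x])^[n] y) atTop (𝓝 x))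

/-- The number `N(g) ∈ {0, 1, …, ∞}` of attracting periodic trajectories of `g`
(distinct trajectories, each counted once as a set of points). -/
def numAttractingTrajectories {S : Type*} [TopologicalSpace S] (g : S → S) : ℕ∞ :=
  Set.encard {O : Set S | ∃ x, IsAttractingPeriodicPt g x ∧ O = Set.range (fun n : ℕ => g^[n] x)}

/-- `F_{r,a}` has rotation number `ρ`: its lift `x ↦ x + 2πr + a f(x)`, written in the coordinate
`x / 2π` in which the circle has length one, is a monotone lift of degree one whose translation
number is `ρ`. (For `C¹` functions `f` the lift is monotone as soon as `|a|` is small.) -/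
def HasRotationNumber (f : Circle2Pi → ℝ) (r a ρ : ℝ) : Prop :=
  ∃ L : CircleDeg1Lift,
    (∀ x : ℝ, L x = x + r + a / (2 * Real.pi) * f ((2 * Real.pi * x : ℝ) : Circle2Pi)) ∧
    L.translationNumber = ρ

/-- `B(F, ρ) = limsup_{a₁ → 0+} sup_{ρ(F_{r,a}) = ρ, |a| < a₁} N(F_{r,a})`. -/
def infinitesimalCyclicity (f : Circle2Pi → ℝ) (ρ : ℝ) : ℕ∞ :=
  limsup (fun a₁ : ℝ =>
    ⨆ (r : ℝ) (a : ℝ) (_ : HasRotationNumber f r a ρ) (_ : |a| < a₁),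
      numAttractingTrajectories (circleMap f r a)) (𝓝[>] 0)

/-! In what follows `X` is a space of real functions on the circle, `ev` the map sending an element
of `X` to the function on the circle that it is. -/

/-- `IC_N(X)`: the infinitesimal cyclicity is bounded by `N`. -/
def IC {X : Type*} (ev : X → Circle2Pi → ℝ) (N : ℕ) : Set X :=
  {f | ∀ ρ : ℝ, infinitesimalCyclicity (ev f) ρ ≤ N}

/-- `IC_fin(X) = ⋃_{N ≥ 1} IC_N(X)`: finite infinitesimal cyclicity. -/
def ICfin {X : Type*} (ev : X → Circle2Pi → ℝ) : Set X :=
  ⋃ (N : ℕ) (_ : 1 ≤ N), IC ev N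

/-- `IC_∞(X) = X \ IC_fin(X)`: infinite infinitesimal cyclicity. -/
def ICinf {X : Type*} (ev : X → Circle2Pi → ℝ) : Set X := (ICfin ev)ᶜ

/-- `IC^e_N(X)`: the infinitesimal cyclicity is essentially bounded by `N`, i.e. `B(F, p/q) ≤ N`
for all fractions `p/q` in lowest terms whose denominator (the period) is large enough. -/
def ICess {X : Type*} (ev : X → Circle2Pi → ℝ) (N : ℕ) : Set X :=
  {f | ∃ Q : ℕ, ∀ p q : ℕ, Q ≤ q → 0 < q → Nat.Coprime p q →
    infinitesimalCyclicity (ev f) ((p : ℝ) / (q : ℝ)) ≤ N}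

/-! ## Cube measures and cube prevalence -/

/-- The standard product measure on the Hilbert cube `[0,1]^ℕ`. -/
def hilbertCubeMeasure : Measure (ℕ → unitInterval) :=
  Measure.infinitePi (fun _ : ℕ => (volume : Measure unitInterval))

section Cube

variable {X : Type*} [NormedAddCommGroup X] [NormedSpace ℝ X] [MeasurableSpace X] [BorelSpace X]

/-- `μ` is a cube measure: the image of the product measure on the Hilbert cube under
`t ↦ x₀ + ∑ tₙ xₙ`, with `xₙ` linearly independent, of dense linear span, `∑ ‖xₙ‖ < ∞`. -/
def IsCubeMeasure (μ : Measure X) : Prop :=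
  ∃ (x₀ : X) (x : ℕ → X),
    LinearIndependent ℝ x ∧
    Dense (Submodule.span ℝ (Set.range x) : Set X) ∧
    Summable (fun n => ‖x n‖) ∧
    μ = hilbertCubeMeasure.map (fun t : ℕ → unitInterval => x₀ + ∑' n, (t n : ℝ) • x n)

/-- `E` is cube null: it has measure zero for every cube measure. -/
def IsCubeNull (E : Set X) : Prop := ∀ μ : Measure X, IsCubeMeasure μ → μ E = 0

/-- `P` is cube prevalent: its complement is cube null. -/
def IsCubePrevalent (P : Set X) : Prop := IsCubeNull Pᶜ

end Cube

/-! ## The space `C^k(S)` -/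

/-- The linear space of real functions on the circle which are `k` times continuously
differentiable (as `2π`-periodic functions on the line). -/
def ckSubmodule (k : ℕ) : Submodule ℝ (Circle2Pi → ℝ) where
  carrier := {f | ContDiff ℝ k (fun x : ℝ => f (x : Circle2Pi))}
  add_mem' := by
    intro f g hf hg
    simp only [Set.mem_ofPred_eq] at hf hg ⊢
    exact hf.add hg
  zero_mem' := by
    simp only [Set.mem_ofPred_eq]
    exact contDiff_const
  smul_mem' := by
    intro c f hf
    simp only [Set.mem_ofPred_eq] at hf ⊢
    exact hf.const_smul c

/-- The space `C^k(S)`. -/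
def Ck (k : ℕ) : Type := ckSubmodule k

namespace Ck

variable {k : ℕ}

instance : AddCommGroup (Ck k) := inferInstanceAs (AddCommGroup (ckSubmodule k))
instance : Module ℝ (Ck k) := inferInstanceAs (Module ℝ (ckSubmodule k))

/-- The function on the circle. -/
def toFun (f : Ck k) : Circle2Pi → ℝ := Subtype.val f

/-- The `2π`-periodic function on the line. -/
def lift (f : Ck k) (x : ℝ) : ℝ := f.toFun (x : Circle2Pi)

theorem contDiff_lift (f : Ck k) : ContDiff ℝ k f.lift := Subtype.property f

theorem periodic_lift (f : Ck k) : Periodic f.lift (2 * Real.pi) := fun x => by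
  simp [lift]

theorem continuous_iteratedDeriv_lift (f : Ck k) (j : Fin (k + 1)) :
    Continuous (iteratedDeriv j f.lift) :=
  f.contDiff_lift.continuous_iteratedDeriv j (by exact_mod_cast Nat.lt_succ_iff.1 j.2)

theorem periodic_iteratedDeriv_lift (f : Ck k) (j : ℕ) :
    Periodic (iteratedDeriv j f.lift) (2 * Real.pi) := fun x => by
  have h := congrFun (iteratedDeriv_comp_add_const j f.lift (2 * Real.pi)) x
  rw [← h]
  congr 1
  exact funext f.periodic_lift

/-- The derivative of order `j ≤ k`, as a bounded continuous function on the line. -/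
def derivBCF (f : Ck k) (j : Fin (k + 1)) : ℝ →ᵇ ℝ :=
  BoundedContinuousFunction.mkOfBound ⟨_, f.continuous_iteratedDeriv_lift j⟩
    (Metric.isBounded_range_iff.1
      ((f.periodic_iteratedDeriv_lift j).isBounded_of_continuous Real.two_pi_pos.ne'
        (f.continuous_iteratedDeriv_lift j))).choose
    (Metric.isBounded_range_iff.1
      ((f.periodic_iteratedDeriv_lift j).isBounded_of_continuous Real.two_pi_pos.ne'
        (f.continuous_iteratedDeriv_lift j))).choose_spec

theorem derivBCF_apply (f : Ck k) (j : Fin (k + 1)) (x : ℝ) :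
    f.derivBCF j x = iteratedDeriv j f.lift x := rfl

/-- `f ↦ (f, f', …, f^(k))`. -/
def jet : Ck k →ₗ[ℝ] (Fin (k + 1) → (ℝ →ᵇ ℝ)) where
  toFun f := f.derivBCF
  map_add' f g := by
    funext j
    ext x
    have hj : ((j : ℕ) : WithTop ℕ∞) ≤ k := by exact_mod_cast Nat.lt_succ_iff.1 j.2
    exact iteratedDeriv_add (f.contDiff_lift.of_le hj).contDiffAt
      (g.contDiff_lift.of_le hj).contDiffAt
  map_smul' c f := by
    funext j
    ext x
    have hj : ((j : ℕ) : WithTop ℕ∞) ≤ k := by exact_mod_cast Nat.lt_succ_iff.1 j.2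
    exact iteratedDeriv_const_smul (f.contDiff_lift.of_le hj).contDiffAt c

theorem jet_injective : Injective (jet : Ck k →ₗ[ℝ] (Fin (k + 1) → (ℝ →ᵇ ℝ))) := by
  intro f g h
  apply Subtype.ext
  funext θ
  induction θ using QuotientAddGroup.induction_on with
  | H x =>
    have := DFunLike.congr_fun (congrFun h 0) x
    change f.derivBCF 0 x = g.derivBCF 0 x at this
    rw [derivBCF_apply, derivBCF_apply] at this
    change iteratedDeriv 0 f.lift x = iteratedDeriv 0 g.lift x at this
    rw [iteratedDeriv_zero, iteratedDeriv_zero] at this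
    exact this

/-- The `C^k` norm `max_{j ≤ k} sup |f^(j)|`. -/
instance : NormedAddCommGroup (Ck k) := NormedAddCommGroup.induced _ _ jet jet_injective
instance : NormedSpace ℝ (Ck k) := NormedSpace.induced ℝ _ _ jet
instance : MeasurableSpace (Ck k) := borel _
instance : BorelSpace (Ck k) := ⟨rfl⟩

theorem norm_def (f : Ck k) : ‖f‖ = ‖f.derivBCF‖ := rfl

end Ck

/-! ## The space `C^ω_δ(S)` -/

/-- The closed strip `|Im z| ≤ δ`. -/
abbrev Strip (δ : ℝ≥0) : Type := {z : ℂ // |z.im| ≤ δ}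

/-- A real number as a point of the strip. -/
def Strip.ofReal {δ : ℝ≥0} (x : ℝ) : Strip δ := ⟨(x : ℂ), by simp⟩

/-- The `2π`-periodic functions which are continuous and bounded on the closed strip `|Im z| ≤ δ`,
holomorphic in the open strip `|Im z| < δ`, and real on the real line. -/
def comegaSubmodule (δ : ℝ≥0) : Submodule ℝ (Strip δ →ᵇ ℂ) where
  carrier := {F |
    (∀ z w : Strip δ, (w : ℂ) = z + 2 * Real.pi → F w = F z) ∧
    (∃ G : ℂ → ℂ, DifferentiableOn ℂ G {z | |z.im| < δ} ∧
      ∀ z : Strip δ, |(z : ℂ).im| < δ → F z = G z) ∧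
    (∀ x : ℝ, (F (Strip.ofReal x)).im = 0)}
  add_mem' := by
    rintro F₁ F₂ ⟨hp₁, ⟨G₁, hG₁, hF₁⟩, hr₁⟩ ⟨hp₂, ⟨G₂, hG₂, hF₂⟩, hr₂⟩
    refine ⟨fun z w h => ?_, ⟨G₁ + G₂, hG₁.add hG₂, fun z hz => ?_⟩, fun x => ?_⟩
    · simp [hp₁ z w h, hp₂ z w h]
    · simp [hF₁ z hz, hF₂ z hz]
    · simp [hr₁, hr₂]
  zero_mem' := ⟨fun _ _ _ => rfl, ⟨0, differentiableOn_const 0, fun _ _ => rfl⟩, fun _ => rfl⟩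
  smul_mem' := by
    rintro c F ⟨hp, ⟨G, hG, hF⟩, hr⟩
    refine ⟨fun z w h => ?_, ⟨c • G, hG.const_smul c, fun z hz => ?_⟩, fun x => ?_⟩
    · simp [hp z w h]
    · simp [hF z hz]
    · simp [hr]

/-- The space `C^ω_δ(S)`, an element being represented by its continuation to the strip, with the
norm `sup |F|` over the strip. -/
def Comega (δ : ℝ≥0) : Type := comegaSubmodule δ

namespace Comega

variable {δ : ℝ≥0}

instance : NormedAddCommGroup (Comega δ) :=
  inferInstanceAs (NormedAddCommGroup (comegaSubmodule δ))
instance : NormedSpace ℝ (Comega δ) := inferInstanceAs (NormedSpace ℝ (comegaSubmodule δ))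
instance : MeasurableSpace (Comega δ) := borel _
instance : BorelSpace (Comega δ) := ⟨rfl⟩

/-- The `2π`-periodic real function on the line. -/
def lift (F : Comega δ) (x : ℝ) : ℝ := (F.1 (Strip.ofReal x)).re

theorem periodic_lift (F : Comega δ) : Periodic (lift F) (2 * Real.pi) := fun x => by
  unfold lift
  rw [F.2.1 (Strip.ofReal x) (Strip.ofReal (x + 2 * Real.pi)) (by simp [Strip.ofReal])]

/-- The function on the circle. -/
def toFun (F : Comega δ) : Circle2Pi → ℝ := (periodic_lift F).lift

end Comega

end CircleFamily

end

noncomputable section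

namespace CircleFamily

/-! ## The universal cover, normalised so that the circle has length one -/

/-! Work on the circle of length one with `φ = f / 2π` and the lift `L x = x + r + a φ(x)`. Its
`q`-th iterate is `x + q r + a ∑ φ(xᵢ)`, the sum running over the first `q` orbit points, so for `a
≠ 0` the periodic points with rotation number `p / q` form a level set of the orbit sum. A fixed
rotation number `p / q` forces `|r - p/q| ≤ |a| sup |φ|`; hence as `a → 0` the orbit sum tends, with
two derivatives, to `∑ φ(x + i p/q)`. That is `q` times the average of `φ` over a rational rotation,
and averaging keeps exactly the Fourier terms whose frequency is a multiple of `q`. The cyclicity at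
`p / q` is therefore read off from the shape of the averaged function.

Take `f = ∑ Bⱼ cos (Mⱼ x)` with `Bⱼ` decreasing extremely fast. The average is then, up to a
constant, the first surviving term with a relative error `2/7`, uniformly also for one or two
derivatives (`abs_average_lacunary_sub_le`). If `Mⱼ = j`, this term is a multiple of `cos (q x)`:
the circle splits into `4q` arcs on each of which the first or the second derivative of the orbit
sum has no zeros, each arc carries at most one attracting point, and there are at most four
attracting trajectories (`infinitesimalCyclicity_le_four`). If `Mⱼ = j · j!` and `q = j!`, this term
is a multiple of `cos (j q x)`, whose `j q` descending crossings of the mean level give `j`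
attracting trajectories at `1 / j!` (`le_infinitesimalCyclicity`).

Both conclusions survive adding `∑ tₘ Bₘ₊₂ eₘ`, `|tₘ| ≤ 1`, over the whole trigonometric system
`eₘ`, because a perturbing term of frequency a nonzero multiple of `q` comes too late in the
sequence to matter. The parameters `t ∈ [0,1]^ℕ` thus fill a cube lying entirely outside the set in
question, and it carries a cube measure because the `eₘ` are independent with dense span
(`exists_isCubeMeasure`). Density is obtained for both function spaces at once by convolving with
the kernels `(1 + cos s)^n`, using only completeness and norm continuity of translations
(`dense_span_trig`). -/

/-- The covering map `ℝ → S` of period one. -/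
def cover (x : ℝ) : Circle2Pi := ((2 * Real.pi * x : ℝ) : Circle2Pi)

theorem continuous_cover : Continuous cover :=
  (AddCircle.continuous_mk' _).comp (by fun_prop)

theorem cover_surjective : Surjective cover := fun θ => by
  obtain ⟨x, rfl⟩ := QuotientAddGroup.mk_surjective θ
  refine ⟨x / (2 * Real.pi), ?_⟩
  unfold cover
  rw [mul_div_cancel₀ _ Real.two_pi_pos.ne']

theorem cover_eq_cover_iff {x y : ℝ} : cover x = cover y ↔ ∃ k : ℤ, y = x + k := by
  unfold cover
  rw [eq_comm, ← sub_eq_zero, ← AddCircle.coe_sub, AddCircle.coe_eq_zero_iff]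
  refine exists_congr fun k => ?_
  have := Real.two_pi_pos
  rw [zsmul_eq_mul, ← mul_sub, mul_comm, mul_right_inj' this.ne']
  constructor <;> intro h <;> linarith

theorem cover_add_int (x : ℝ) (k : ℤ) : cover (x + k) = cover x :=
  (cover_eq_cover_iff.2 ⟨k, rfl⟩).symm

theorem cover_sub_int (x : ℝ) (k : ℤ) : cover (x - k) = cover x :=
  cover_eq_cover_iff.2 ⟨k, by ring⟩

theorem semiconj_cover_circleMap {f : Circle2Pi → ℝ} {r a : ℝ} {L : ℝ → ℝ}
    (hL : ∀ x, L x = x + r + a / (2 * Real.pi) * f (cover x)) :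
    Semiconj cover L (circleMap f r a) := fun x => by
  unfold circleMap
  rw [hL]
  unfold cover
  rw [← AddCircle.coe_add]
  congr 1
  have := Real.pi_ne_zero
  field_simp
  ring

/-! ## Attracting fixed points of circle maps with a monotone lift -/

/-- `x` attracts a neighbourhood under the iterates of `g`. -/
def AttractsNhd {S : Type*} [TopologicalSpace S] (g : S → S) (x : S) : Prop :=
  ∃ V ∈ 𝓝 x, ∀ y ∈ V, Tendsto (fun n : ℕ => g^[n] y) atTop (𝓝 x)

/-- Attraction is carried along the orbit: follow a point near `g^[i] x` forward by `q - i` steps to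
reach the neighbourhood of `x`, converge there, and apply `g^[i]`. This makes every point of an
attracting trajectory available for counting. -/
theorem AttractsNhd.iterate {S : Type*} [TopologicalSpace S] {g : S → S} (hg : Continuous g)
    {x : S} {q : ℕ} (hx : IsPeriodicPt g q x) (h : AttractsNhd g^[q] x) {i : ℕ} (hi : i ≤ q) :
    AttractsNhd g^[q] (g^[i] x) := by
  obtain ⟨V, hV, hVt⟩ := h
  have hback : g^[q - i] (g^[i] x) = x := by
    rw [← iterate_add_apply, Nat.sub_add_cancel hi]; exact hx
  refine ⟨g^[q - i] ⁻¹' V, (hg.iterate _).continuousAt.preimage_mem_nhds (by rwa [hback]), ?_⟩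
  intro y hy
  rw [← tendsto_add_atTop_iff_nat 1]
  have h1 := ((hg.iterate i).tendsto x).comp (hVt _ hy)
  refine h1.congr fun n => ?_
  simp only [comp_apply]
  rw [iterate_succ_apply, ← iterate_mul, ← iterate_add_apply, ← iterate_add_apply,
    ← iterate_add_apply]
  congr 1
  omega

/-- A compact interval has closed image in the circle, so a limit on the circle lifts back into the
interval. This replaces convergence of the lifts, which is not given. -/
theorem exists_int_add_mem_of_tendsto {u : ℕ → ℝ} {a b x : ℝ} (hu : ∀ n, u n ∈ Set.Icc a b)
    (h : Tendsto (fun n => cover (u n)) atTop (𝓝 (cover x))) :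
    ∃ k : ℤ, x + k ∈ Set.Icc a b := by
  have hc : IsClosed (cover '' Set.Icc a b) := (isCompact_Icc.image continuous_cover).isClosed
  obtain ⟨y, hy, hyx⟩ := hc.mem_of_tendsto h (Eventually.of_forall fun n => ⟨_, hu n, rfl⟩)
  obtain ⟨k, rfl⟩ := cover_eq_cover_iff.1 hyx.symm
  exact ⟨k, hy⟩

/-- Without a fixed point in between, `G - id` has one sign on `(x, y)`. Orbits starting there next
to one of the two ends move away from it and stay trapped before the other, in an interval that
contains no integer translate of the first end since `y - x < 1`; so that end does not attract. -/
theorem exists_fixed_between {G : ℝ → ℝ} (hmono : Monotone G) (hcont : Continuous G)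
    {g : Circle2Pi → Circle2Pi} (hs : Semiconj cover G g) {x y : ℝ} (hxy : x < y) (hyx : y < x + 1)
    (hx : G x = x) (hy : G y = y) (hax : AttractsNhd g (cover x))
    (hay : AttractsNhd g (cover y)) : ∃ z ∈ Set.Ioo x y, G z = z := by
  by_contra hno
  push Not at hno
  have hcover : ∀ n z, g^[n] (cover z) = cover (G^[n] z) := fun n z =>
    ((hs.iterate_right n) z).symm
  have hsign : (∀ z ∈ Set.Ioo x y, z < G z) ∨ (∀ z ∈ Set.Ioo x y, G z < z) := by
    by_contra! hc
    obtain ⟨⟨z, hz, hz'⟩, w, hw, hw'⟩ := hc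
    obtain ⟨v, hv, hv'⟩ := (isPreconnected_Ioo (a := x) (b := y)).intermediate_value₂ hz hw
      hcont.continuousOn continuousOn_id hz' hw'
    exact hno v hv hv'
  rcases hsign with hs' | hs'
  · obtain ⟨V, hV, hVt⟩ := hax
    have h1 : ∀ᶠ z in 𝓝[>] x, z ∈ Set.Ioo x y ∧ cover z ∈ V :=
      Filter.Eventually.and (Ioo_mem_nhdsGT hxy)
        (nhdsWithin_le_nhds (continuous_cover.continuousAt.preimage_mem_nhds hV))
    obtain ⟨z, hz, hzV⟩ := h1.exists
    have hst : ∀ n, G^[n] z ∈ Set.Icc z y := by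
      intro n
      induction n with
      | zero => exact ⟨le_rfl, hz.2.le⟩
      | succ n ih =>
        rw [iterate_succ_apply']
        exact ⟨(hs' z hz).le.trans (hmono ih.1), (hmono ih.2).trans hy.le⟩
    obtain ⟨k, hk⟩ := exists_int_add_mem_of_tendsto hst
      ((hVt _ hzV).congr fun n => hcover n z)
    have h2 : (0 : ℝ) < k := by linarith [hk.1, hz.1]
    have h3 : (k : ℝ) < 1 := by linarith [hk.2]
    have h4 : 0 < k := by exact_mod_cast h2
    have h5 : k < 1 := by exact_mod_cast h3
    omega
  · obtain ⟨V, hV, hVt⟩ := hay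
    have h1 : ∀ᶠ z in 𝓝[<] y, z ∈ Set.Ioo x y ∧ cover z ∈ V :=
      Filter.Eventually.and (Ioo_mem_nhdsLT hxy)
        (nhdsWithin_le_nhds (continuous_cover.continuousAt.preimage_mem_nhds hV))
    obtain ⟨z, hz, hzV⟩ := h1.exists
    have hst : ∀ n, G^[n] z ∈ Set.Icc x z := by
      intro n
      induction n with
      | zero => exact ⟨hz.1.le, le_rfl⟩
      | succ n ih =>
        rw [iterate_succ_apply']
        exact ⟨hx.symm.le.trans (hmono ih.1), (hmono ih.2).trans (hs' z hz).le⟩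
    obtain ⟨k, hk⟩ := exists_int_add_mem_of_tendsto hst
      ((hVt _ hzV).congr fun n => hcover n z)
    have h2 : (-1 : ℝ) < k := by linarith [hk.1, hz.1]
    have h3 : (k : ℝ) < 0 := by linarith [hk.2, hz.2]
    have h4 : -1 < k := by exact_mod_cast h2
    have h5 : k < 0 := by exact_mod_cast h3
    omega

/-- A fixed point of a monotone lift at which `G - id` changes sign from plus to minus is
asymptotically stable. -/
theorem stable_of_sign_change {G : ℝ → ℝ} (hmono : Monotone G) (hcont : Continuous G)
    {g : Circle2Pi → Circle2Pi} (hs : Semiconj cover G g) {x l u : ℝ} (hlx : l < x) (hxu : x < u)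
    (hx : G x = x) (hl : ∀ z ∈ Set.Ico l x, z < G z) (hu : ∀ z ∈ Set.Ioc x u, G z < z) :
    (∀ U ∈ 𝓝 (cover x), ∃ V ∈ 𝓝 (cover x), ∀ y ∈ V, ∀ n : ℕ, g^[n] y ∈ U) ∧
      AttractsNhd g (cover x) := by
  have hcover : ∀ n z, g^[n] (cover z) = cover (G^[n] z) := fun n z =>
    ((hs.iterate_right n) z).symm
  have hopen : IsOpenMap cover :=
    (QuotientAddGroup.isOpenMap_coe).comp
      (Homeomorph.mulLeft₀ (2 * Real.pi) Real.two_pi_pos.ne').isOpenMap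
  have hnear : ∀ s ∈ 𝓝 x, cover '' s ∈ 𝓝 (cover x) := fun s hs => hopen.image_mem_nhds hs
  -- On either side of `x` the orbit is monotone and cannot jump over `x`, because `G` is monotone
  -- and fixes `x`.
  have hleft : ∀ z ∈ Set.Icc l x, ∀ n, G^[n] z ∈ Set.Icc z x ∧ G^[n] z ≤ G^[n + 1] z := by
    intro z hz n
    have hle : ∀ w ∈ Set.Icc l x, w ≤ G w := fun w hw => by
      rcases hw.2.eq_or_lt with rfl | h
      · exact hx.ge
      · exact (hl w ⟨hw.1, h⟩).le
    induction n with
    | zero => exact ⟨⟨le_rfl, hz.2⟩, hle z hz⟩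
    | succ n ih =>
      have h1 : G^[n + 1] z ∈ Set.Icc z x := by
        refine ⟨ih.1.1.trans ih.2, ?_⟩
        rw [iterate_succ_apply']
        exact (hmono ih.1.2).trans hx.le
      refine ⟨h1, ?_⟩
      rw [iterate_succ_apply' G (n + 1)]
      exact hle _ ⟨hz.1.trans h1.1, h1.2⟩
  have hright : ∀ z ∈ Set.Icc x u, ∀ n, G^[n] z ∈ Set.Icc x z ∧ G^[n + 1] z ≤ G^[n] z := by
    intro z hz n
    have hle : ∀ w ∈ Set.Icc x u, G w ≤ w := fun w hw => by
      rcases hw.1.eq_or_lt with rfl | h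
      · exact hx.le
      · exact (hu w ⟨h, hw.2⟩).le
    induction n with
    | zero => exact ⟨⟨hz.1, le_rfl⟩, hle z hz⟩
    | succ n ih =>
      have h1 : G^[n + 1] z ∈ Set.Icc x z := by
        refine ⟨?_, ih.2.trans ih.1.2⟩
        rw [iterate_succ_apply']
        exact hx.ge.trans (hmono ih.1.1)
      refine ⟨h1, ?_⟩
      rw [iterate_succ_apply' G (n + 1)]
      exact hle _ ⟨h1.1, h1.2.trans hz.2⟩
  constructor
  · intro U hU
    have hpre : cover ⁻¹' U ∈ 𝓝 x := continuous_cover.continuousAt.preimage_mem_nhds hU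
    obtain ⟨ε, hε, hball⟩ := Metric.mem_nhds_iff.1 hpre
    obtain ⟨η, hη, hηε⟩ : ∃ η > 0, η < ε ∧ η ≤ x - l ∧ η ≤ u - x :=
      ⟨min (ε / 2) (min (x - l) (u - x)), by
        simp only [gt_iff_lt, lt_min_iff, sub_pos]; exact ⟨half_pos hε, hlx, hxu⟩,
        (min_le_left _ _).trans_lt (half_lt_self hε),
        (min_le_right _ _).trans (min_le_left _ _), (min_le_right _ _).trans (min_le_right _ _)⟩
    refine ⟨_, hnear _ (Icc_mem_nhds (sub_lt_self x hη) (lt_add_of_pos_right x hη)), ?_⟩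
    rintro _ ⟨z, hz, rfl⟩ n
    rw [hcover]
    apply hball
    rw [Metric.mem_ball, Real.dist_eq, abs_lt]
    rcases le_total z x with h | h
    · have := (hleft z ⟨by linarith [hz.1], h⟩ n).1
      constructor <;> linarith [this.1, this.2, hz.1]
    · have := (hright z ⟨h, by linarith [hz.2]⟩ n).1
      constructor <;> linarith [this.1, this.2, hz.2]
  · refine ⟨_, hnear _ (Icc_mem_nhds hlx hxu), ?_⟩
    rintro _ ⟨z, hz, rfl⟩
    have key : Tendsto (fun n => G^[n] z) atTop (𝓝 x) := by
      -- The monotone orbits converge, their limits are fixed by `G`, and the sign condition leaves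
      -- `x` as the only candidate.
      have hfix : ∀ c, Tendsto (fun n => G^[n] z) atTop (𝓝 c) → G c = c := fun c hc => by
        have h1 := hc.comp (tendsto_add_atTop_nat 1)
        have h2 := (hcont.tendsto c).comp hc
        refine tendsto_nhds_unique h2 (h1.congr fun n => ?_)
        simp only [comp_apply, iterate_succ_apply']
      rcases le_total z x with h | h
      · have hz' : z ∈ Set.Icc l x := ⟨hz.1, h⟩
        have hm : Monotone fun n => G^[n] z := monotone_nat_of_le_succ fun n => (hleft z hz' n).2
        have hb : BddAbove (Set.range fun n => G^[n] z) :=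
          ⟨x, by rintro _ ⟨n, rfl⟩; exact (hleft z hz' n).1.2⟩
        have ht := tendsto_atTop_ciSup hm hb
        set c := ⨆ n, G^[n] z
        have hc1 : c ∈ Set.Icc z x :=
          isClosed_Icc.mem_of_tendsto ht (Eventually.of_forall fun n => (hleft z hz' n).1)
        have : c = x := by
          by_contra hne
          exact (hl c ⟨hz.1.trans hc1.1, lt_of_le_of_ne hc1.2 hne⟩).ne' (hfix c ht)
        rwa [this] at ht
      · have hz' : z ∈ Set.Icc x u := ⟨h, hz.2⟩
        have hm : Antitone fun n => G^[n] z := antitone_nat_of_succ_le fun n => (hright z hz' n).2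
        have hb : BddBelow (Set.range fun n => G^[n] z) :=
          ⟨x, by rintro _ ⟨n, rfl⟩; exact (hright z hz' n).1.1⟩
        have ht := tendsto_atTop_ciInf hm hb
        set c := ⨅ n, G^[n] z
        have hc1 : c ∈ Set.Icc x z :=
          isClosed_Icc.mem_of_tendsto ht (Eventually.of_forall fun n => (hright z hz' n).1)
        have : c = x := by
          by_contra hne
          exact (hu c ⟨lt_of_le_of_ne hc1.1 (Ne.symm hne), hc1.2.trans hz.2⟩).ne (hfix c ht)
        rwa [this] at ht
    exact ((continuous_cover.tendsto x).comp key).congr fun n => (hcover n z).symm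

/-! ## Rotation numbers and periods -/

theorem rotationNumber_of_iterate {L : CircleDeg1Lift} {q : ℕ} (hq : 0 < q) {x : ℝ} {p : ℤ}
    (h : L^[q] x = x + p) : L.translationNumber = p / q :=
  L.translationNumber_of_map_pow_eq_add_int (by rwa [L.coe_pow]) hq

theorem exists_iterate_eq_of_isPeriodicPt {L : CircleDeg1Lift} {g : Circle2Pi → Circle2Pi}
    (hs : Semiconj cover L g) {n : ℕ} {x : ℝ} (hx : IsPeriodicPt g n (cover x)) :
    ∃ m : ℤ, L^[n] x = x + m := by
  have h : g^[n] (cover x) = cover x := hx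
  rw [← (hs.iterate_right n) x, eq_comm] at h
  exact cover_eq_cover_iff.1 h

/-- A monotone lift that falls behind (or runs ahead of) the translation by `p` after `q` steps can
never make up for it. -/
theorem iterate_eq_add_of_iterate_mul {L : CircleDeg1Lift} {q d : ℕ} (hd : d ≠ 0) {p : ℤ} {x : ℝ}
    (h : L^[q * d] x = x + (d * p : ℤ)) : L^[q] x = x + p := by
  have hmono : Monotone L^[q] := L.monotone.iterate q
  have hadd : ∀ y (m : ℤ), L^[q] (y + m) = L^[q] y + m := fun y m => by
    rw [← L.coe_pow]; exact (L ^ q).map_add_int y m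
  obtain ⟨d, rfl⟩ := Nat.exists_eq_succ_of_ne_zero hd
  rw [iterate_mul, iterate_succ_apply'] at h
  rcases lt_trichotomy (L^[q] x) (x + p) with hlt | heq | hgt
  · exfalso
    -- The weak inequality is enough for the first `d` blocks of `q` steps; strictness comes from
    -- the one remaining block.
    have : ∀ n : ℕ, (L^[q])^[n] x ≤ x + (n * p : ℤ) := fun n => by
      induction n with
      | zero => simp
      | succ n ih =>
        rw [iterate_succ_apply']
        refine (hmono ih).trans ?_
        rw [hadd]; push_cast; linarith
    have h2 := hmono (this d)
    rw [h, hadd] at h2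
    push_cast at h2
    linarith
  · exact heq
  · exfalso
    have : ∀ n : ℕ, x + (n * p : ℤ) ≤ (L^[q])^[n] x := fun n => by
      induction n with
      | zero => simp
      | succ n ih =>
        rw [iterate_succ_apply']
        refine le_trans ?_ (hmono ih)
        rw [hadd]; push_cast; linarith
    have h2 := hmono (this d)
    rw [h, hadd] at h2
    push_cast at h2
    linarith

/-- For a circle map with rotation number `p / q` in lowest terms, the periodic points are those
whose lifts satisfy `L^q x = x + p`, and their minimal period is `q`. -/
theorem minimalPeriod_of_rotationNumber {L : CircleDeg1Lift} {g : Circle2Pi → Circle2Pi}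
    (hs : Semiconj cover L g) {p : ℤ} {q : ℕ} (hq : 0 < q) (hpq : IsCoprime p (q : ℤ))
    (hρ : L.translationNumber = p / q) {x : ℝ} (hx : cover x ∈ periodicPts g) :
    minimalPeriod g (cover x) = q ∧ L^[q] x = x + p := by
  have hn := minimalPeriod_pos_of_mem_periodicPts hx
  obtain ⟨m, hm⟩ := exists_iterate_eq_of_isPeriodicPt hs (isPeriodicPt_minimalPeriod g (cover x))
  set n := minimalPeriod g (cover x) with hndef
  have h1 := rotationNumber_of_iterate hn hm
  rw [hρ, div_eq_div_iff (by positivity) (by positivity)] at h1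
  have h2 : p * n = m * q := by exact_mod_cast h1
  -- Equality of the two expressions for the rotation number gives `p n = m q`, and coprimality
  -- makes the minimal period a multiple of `q`.
  have h3 : (q : ℤ) ∣ n := hpq.symm.dvd_of_dvd_mul_left (Dvd.intro_left m h2.symm)
  obtain ⟨d, hd⟩ := Int.natCast_dvd_natCast.1 h3
  have hd0 : d ≠ 0 := by rintro rfl; simp at hd; omega
  have h4 : m = d * p := by
    have hqz : (q : ℤ) ≠ 0 := by exact_mod_cast hq.ne'
    apply mul_right_cancel₀ hqz
    rw [← h2, hd]; push_cast; ring
  rw [hd, h4] at hm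
  have h5 := iterate_eq_add_of_iterate_mul hd0 hm
  refine ⟨?_, h5⟩
  apply Nat.dvd_antisymm
  · apply IsPeriodicPt.minimalPeriod_dvd
    change g^[q] (cover x) = cover x
    rw [← (hs.iterate_right q) x, h5, cover_add_int]
  · exact Dvd.intro _ hd.symm

/-! ## Counting trajectories -/

theorem mem_range_iterate_of_iterate {S : Type*} {g : S → S} {x : S} {q : ℕ} (hq : 0 < q)
    (hx : IsPeriodicPt g q x) (i : ℕ) : x ∈ Set.range fun n => g^[n] (g^[i] x) := by
  refine ⟨q * i - i, ?_⟩
  change g^[q * i - i] (g^[i] x) = x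
  rw [← iterate_add_apply, Nat.sub_add_cancel (Nat.le_mul_of_pos_left i hq)]
  exact hx.mul_const i

theorem range_iterate_iterate {S : Type*} {g : S → S} {x : S} {q : ℕ} (hq : 0 < q)
    (hx : IsPeriodicPt g q x) (i : ℕ) :
    (Set.range fun n => g^[n] (g^[i] x)) = Set.range fun n => g^[n] x := by
  apply Set.Subset.antisymm
  · rintro _ ⟨n, rfl⟩
    exact ⟨n + i, iterate_add_apply g n i x⟩
  · rintro _ ⟨n, rfl⟩
    obtain ⟨m, hm⟩ := mem_range_iterate_of_iterate hq hx i
    refine ⟨n + m, ?_⟩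
    change g^[n + m] (g^[i] x) = g^[n] x
    rw [iterate_add_apply]
    exact congrArg _ hm

/-- If there are at most `N q` points of period `q` attracting a neighbourhood, and all attracting
periodic points have period `q`, then there are at most `N` attracting trajectories. -/
theorem numAttractingTrajectories_le {S : Type*} [TopologicalSpace S] {g : S → S}
    (hg : Continuous g) {q N : ℕ} (hq : 0 < q)
    (hper : ∀ x, IsAttractingPeriodicPt g x → minimalPeriod g x = q)
    (hcard : {x | minimalPeriod g x = q ∧ AttractsNhd g^[q] x}.encard ≤ N * q) :
    numAttractingTrajectories g ≤ N := by
  by_contra! hlt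
  -- Exactly `N + 1` trajectories are selected, so that the count stays finite even if there are
  -- infinitely many; with `q` points on each they exceed the bound `N q`.
  obtain ⟨T, hT, hTc⟩ := Set.exists_subset_encard_eq (Order.add_one_le_of_lt hlt)
  have hrep : ∀ O : Set S, ∃ x, O ∈ T → IsAttractingPeriodicPt g x ∧
      O = Set.range (fun n : ℕ => g^[n] x) := fun O => by
    by_cases hO : O ∈ T
    · obtain ⟨x, hx⟩ := hT hO; exact ⟨x, fun _ => hx⟩
    · rcases isEmpty_or_nonempty S with h | ⟨⟨x⟩⟩
      · exfalso
        obtain ⟨O, hO⟩ : T.Nonempty := by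
          rw [← Set.encard_ne_zero, hTc]; simp
        obtain ⟨x, -⟩ := hT hO
        exact h.elim x
      · exact ⟨x, fun h => absurd h hO⟩
  choose rep hrep using hrep
  have hinj : Set.InjOn (fun y : Set S × ℕ => g^[y.2] (rep y.1)) (T ×ˢ Set.Iio q) := by
    rintro ⟨O, i⟩ ⟨hO, hi⟩ ⟨O', j⟩ ⟨hO', hj⟩ heq
    simp only at heq hO hO' hi hj
    have h1 := hrep O hO
    have h2 := hrep O' hO'
    have p1 : IsPeriodicPt g q (rep O) := by
      rw [← hper _ h1.1]; exact isPeriodicPt_minimalPeriod _ _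
    have p2 : IsPeriodicPt g q (rep O') := by
      rw [← hper _ h2.1]; exact isPeriodicPt_minimalPeriod _ _
    have hOO : O = O' := by
      rw [h1.2, h2.2, ← range_iterate_iterate hq p1 i, heq, range_iterate_iterate hq p2 j]
    subst hOO
    have := iterate_injOn_Iio_minimalPeriod (f := g) (x := rep O)
      (by rw [hper _ h1.1]; exact hi) (by rw [hper _ h1.1]; exact hj) heq
    rw [this]
  have hmaps : Set.MapsTo (fun y : Set S × ℕ => g^[y.2] (rep y.1)) (T ×ˢ Set.Iio q)
      {x | minimalPeriod g x = q ∧ AttractsNhd g^[q] x} := by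
    rintro ⟨O, i⟩ ⟨hO, hi⟩
    have h1 := (hrep O hO).1
    have hp := hper _ h1
    have p1 : IsPeriodicPt g q (rep O) := by
      rw [← hp]; exact isPeriodicPt_minimalPeriod _ _
    refine ⟨by rw [minimalPeriod_apply_iterate h1.1, hp], AttractsNhd.iterate hg p1 ?_ (le_of_lt hi)⟩
    have := h1.2.2
    rwa [hp] at this
  have h1 := Set.encard_le_encard_of_injOn hmaps hinj
  have h2 : (T ×ˢ Set.Iio q).encard = ((N + 1) * q : ℕ) := by
    rw [Set.encard_prod, hTc, ← Finset.coe_Iio, Set.encard_coe_eq_coe_finsetCard, Nat.card_Iio]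
    push_cast; rfl
  rw [h2] at h1
  have h3 : (((N + 1) * q : ℕ) : ℕ∞) ≤ (N * q : ℕ) := by
    refine (h1.trans hcard).trans ?_
    push_cast; rfl
  have h4 : (N + 1) * q ≤ N * q := by exact_mod_cast h3
  have := Nat.le_of_mul_le_mul_right h4 hq
  omega

/-- `N q` distinct attracting points of period `q` lie on at least `N` trajectories. -/
theorem le_numAttractingTrajectories {S : Type*} [TopologicalSpace S] {g : S → S} {q N : ℕ}
    (hq : 0 < q) (s : ℕ → S) (hinj : Set.InjOn s (Set.Iio (N * q)))
    (hs : ∀ k < N * q, minimalPeriod g (s k) = q ∧ IsAttractingPeriodicPt g (s k)) :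
    (N : ℕ∞) ≤ numAttractingTrajectories g := by
  set T : Set (Set S) := (fun k => Set.range (fun n : ℕ => g^[n] (s k))) '' Set.Iio (N * q)
  have hT : T.encard ≤ numAttractingTrajectories g := by
    apply Set.encard_le_encard
    rintro _ ⟨k, hk, rfl⟩
    exact ⟨s k, (hs k hk).2, rfl⟩
  refine le_trans ?_ hT
  have hrep : ∀ O ∈ T, ∃ k < N * q, O = Set.range (fun n : ℕ => g^[n] (s k)) := by
    rintro _ ⟨k, hk, rfl⟩
    exact ⟨k, hk, rfl⟩
  choose! rep hrep using hrep
  -- A point is determined by its trajectory and by a position below `q` relative to the chosen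
  -- representative, so each trajectory accounts for at most `q` of the points.
  have hidx : ∀ k < N * q, ∃ i < q,
      s k = g^[i] (s (rep (Set.range (fun n : ℕ => g^[n] (s k))))) := fun k hk => by
    obtain ⟨h1, h2⟩ := hrep (Set.range (fun n : ℕ => g^[n] (s k))) ⟨k, hk, rfl⟩
    have h3 : s k ∈ Set.range (fun n : ℕ => g^[n] (s k)) := ⟨0, rfl⟩
    rw [h2] at h3
    obtain ⟨n, hn⟩ := h3
    refine ⟨n % q, Nat.mod_lt _ hq, ?_⟩
    have := iterate_mod_minimalPeriod_eq (f := g) (n := n)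
      (x := s (rep (Set.range (fun n : ℕ => g^[n] (s k)))))
    rw [(hs _ h1).1] at this
    rw [this]
    exact hn.symm
  choose! idx hidx using hidx
  have hinj' : Set.InjOn (fun k => (Set.range (fun n : ℕ => g^[n] (s k)), idx k))
      (Set.Iio (N * q)) := by
    intro k hk l hl h
    obtain ⟨h1, h2⟩ := Prod.mk.inj h
    apply hinj hk hl
    rw [(hidx k hk).2, (hidx l hl).2, h1, h2]
  have hmaps : Set.MapsTo (fun k => (Set.range (fun n : ℕ => g^[n] (s k)), idx k))
      (Set.Iio (N * q)) (T ×ˢ Set.Iio q) := fun k hk => ⟨⟨k, hk, rfl⟩, (hidx k hk).1⟩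
  have h1 := Set.encard_le_encard_of_injOn hmaps hinj'
  rw [Set.encard_prod, ← Finset.coe_Iio, Set.encard_coe_eq_coe_finsetCard, Nat.card_Iio,
    ← Finset.coe_Iio, Set.encard_coe_eq_coe_finsetCard, Nat.card_Iio] at h1
  by_contra! hlt
  obtain ⟨t, ht⟩ := ENat.ne_top_iff_exists.1 (ne_top_of_lt hlt)
  rw [← ht] at h1 hlt
  have h3 : N * q ≤ t * q := by exact_mod_cast h1
  have h4 : t < N := by exact_mod_cast hlt
  exact absurd (Nat.le_of_mul_le_mul_right h3 hq) (by omega)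

/-! ## Orbits of a family of lifts and their derivatives -/

section Orbit

variable (φ φ₁ φ₂ : ℝ → ℝ)

/-- The orbit of `x` under `y ↦ y + r + a φ(y)`, where `v = (r, a)`. -/
def orb : ℕ → ℝ × ℝ → ℝ → ℝ
  | 0, _, x => x
  | i + 1, v, x => orb i v x + v.1 + v.2 * φ (orb i v x)

/-- The derivative of `orb` in the initial point. -/
def orbD : ℕ → ℝ × ℝ → ℝ → ℝ
  | 0, _, _ => 1
  | i + 1, v, x => orbD i v x * (1 + v.2 * φ₁ (orb φ i v x))

/-- The second derivative of `orb` in the initial point. -/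
def orbDD : ℕ → ℝ × ℝ → ℝ → ℝ
  | 0, _, _ => 0
  | i + 1, v, x => orbDD i v x * (1 + v.2 * φ₁ (orb φ i v x)) +
      orbD φ φ₁ i v x * (v.2 * (φ₂ (orb φ i v x) * orbD φ φ₁ i v x))

/-- The sum of `φ` along the orbit. -/
def orbSum (q : ℕ) (v : ℝ × ℝ) (x : ℝ) : ℝ := ∑ i ∈ Finset.range q, φ (orb φ i v x)

/-- The derivative of `orbSum`. -/
def orbSumD (q : ℕ) (v : ℝ × ℝ) (x : ℝ) : ℝ :=
  ∑ i ∈ Finset.range q, φ₁ (orb φ i v x) * orbD φ φ₁ i v x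

/-- The second derivative of `orbSum`. -/
def orbSumDD (q : ℕ) (v : ℝ × ℝ) (x : ℝ) : ℝ :=
  ∑ i ∈ Finset.range q, (φ₂ (orb φ i v x) * orbD φ φ₁ i v x * orbD φ φ₁ i v x +
    φ₁ (orb φ i v x) * orbDD φ φ₁ φ₂ i v x)

variable {φ φ₁ φ₂}

theorem orb_eq_iterate (L : ℝ → ℝ) (v : ℝ × ℝ) (hL : ∀ x, L x = x + v.1 + v.2 * φ x) (i : ℕ)
    (x : ℝ) : orb φ i v x = L^[i] x := by
  induction i with
  | zero => rfl
  | succ i ih => rw [iterate_succ_apply', hL, ← ih, orb]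

/-- This turns the fixed point equation for the `q`-th iterate into a level set equation for
`orbSum`, which, unlike the iterate itself, does not degenerate as `a → 0`. -/
theorem orb_eq_add_orbSum (q : ℕ) (v : ℝ × ℝ) (x : ℝ) :
    orb φ q v x = x + q * v.1 + v.2 * orbSum φ q v x := by
  induction q with
  | zero => simp [orb, orbSum]
  | succ q ih =>
    rw [orb, orbSum, Finset.sum_range_succ, ← orbSum, mul_add]
    nth_rewrite 1 [ih]
    push_cast; ring

theorem orb_zero_right (i : ℕ) (r x : ℝ) : orb φ i (r, 0) x = x + i * r := by
  rw [orb_eq_add_orbSum]; simp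

theorem orbD_zero_right (i : ℕ) (r x : ℝ) : orbD φ φ₁ i (r, 0) x = 1 := by
  induction i with
  | zero => rfl
  | succ i ih => simp [orbD, ih]

theorem orbDD_zero_right (i : ℕ) (r x : ℝ) : orbDD φ φ₁ φ₂ i (r, 0) x = 0 := by
  induction i with
  | zero => rfl
  | succ i ih => simp [orbDD, ih]

theorem orbSum_zero_right (q : ℕ) (r x : ℝ) :
    orbSum φ q (r, 0) x = ∑ i ∈ Finset.range q, φ (x + i * r) := by
  simp [orbSum, orb_zero_right]

theorem orbSumD_zero_right (q : ℕ) (r x : ℝ) :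
    orbSumD φ φ₁ q (r, 0) x = ∑ i ∈ Finset.range q, φ₁ (x + i * r) := by
  simp [orbSumD, orb_zero_right, orbD_zero_right]

theorem orbSumDD_zero_right (q : ℕ) (r x : ℝ) :
    orbSumDD φ φ₁ φ₂ q (r, 0) x = ∑ i ∈ Finset.range q, φ₂ (x + i * r) := by
  simp [orbSumDD, orb_zero_right, orbD_zero_right, orbDD_zero_right]

theorem hasDerivAt_orb (h₁ : ∀ x, HasDerivAt φ (φ₁ x) x) (i : ℕ) (v : ℝ × ℝ) (x : ℝ) :
    HasDerivAt (orb φ i v) (orbD φ φ₁ i v x) x := by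
  induction i with
  | zero => exact hasDerivAt_id x
  | succ i ih =>
    have := (ih.add_const v.1).add (((h₁ (orb φ i v x)).comp x ih).const_mul v.2)
    refine this.congr_deriv ?_
    rw [orbD]; ring

theorem hasDerivAt_orbD (h₁ : ∀ x, HasDerivAt φ (φ₁ x) x) (h₂ : ∀ x, HasDerivAt φ₁ (φ₂ x) x)
    (i : ℕ) (v : ℝ × ℝ) (x : ℝ) :
    HasDerivAt (orbD φ φ₁ i v) (orbDD φ φ₁ φ₂ i v x) x := by
  induction i with
  | zero => exact hasDerivAt_const x 1
  | succ i ih =>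
    exact ih.mul ((((h₂ (orb φ i v x)).comp x (hasDerivAt_orb h₁ i v x)).const_mul v.2).const_add 1)

theorem hasDerivAt_orbSum (h₁ : ∀ x, HasDerivAt φ (φ₁ x) x) (q : ℕ) (v : ℝ × ℝ) (x : ℝ) :
    HasDerivAt (orbSum φ q v) (orbSumD φ φ₁ q v x) x :=
  HasDerivAt.fun_sum fun i _ => (h₁ (orb φ i v x)).comp x (hasDerivAt_orb h₁ i v x)

theorem hasDerivAt_orbSumD (h₁ : ∀ x, HasDerivAt φ (φ₁ x) x) (h₂ : ∀ x, HasDerivAt φ₁ (φ₂ x) x)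
    (q : ℕ) (v : ℝ × ℝ) (x : ℝ) :
    HasDerivAt (orbSumD φ φ₁ q v) (orbSumDD φ φ₁ φ₂ q v x) x :=
  HasDerivAt.fun_sum fun i _ => (((h₂ (orb φ i v x)).comp x (hasDerivAt_orb h₁ i v x)).mul
    (hasDerivAt_orbD h₁ h₂ i v x))

theorem continuous_orb (h : Continuous φ) (i : ℕ) : Continuous (uncurry (orb φ i)) := by
  induction i with
  | zero => exact continuous_snd
  | succ i ih =>
    exact (ih.add (continuous_fst.fst)).add (continuous_fst.snd.mul (h.comp ih))

theorem continuous_orbD (h : Continuous φ) (h₁ : Continuous φ₁) (i : ℕ) :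
    Continuous (uncurry (orbD φ φ₁ i)) := by
  induction i with
  | zero => exact continuous_const
  | succ i ih =>
    exact ih.mul (continuous_const.add (continuous_fst.snd.mul (h₁.comp (continuous_orb h i))))

theorem continuous_orbDD (h : Continuous φ) (h₁ : Continuous φ₁) (h₂ : Continuous φ₂) (i : ℕ) :
    Continuous (uncurry (orbDD φ φ₁ φ₂ i)) := by
  induction i with
  | zero => exact continuous_const
  | succ i ih =>
    exact (ih.mul (continuous_const.add (continuous_fst.snd.mul (h₁.comp (continuous_orb h i))))).add
      ((continuous_orbD h h₁ i).mul (continuous_fst.snd.mul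
        ((h₂.comp (continuous_orb h i)).mul (continuous_orbD h h₁ i))))

theorem continuous_orbSum (h : Continuous φ) (q : ℕ) : Continuous (uncurry (orbSum φ q)) :=
  (continuous_finsetSum (Finset.range q) fun i _ => h.comp (continuous_orb h i)).congr
    fun _ => rfl

theorem continuous_orbSumD (h : Continuous φ) (h₁ : Continuous φ₁) (q : ℕ) :
    Continuous (uncurry (orbSumD φ φ₁ q)) :=
  (continuous_finsetSum (Finset.range q) fun i _ =>
    (h₁.comp (continuous_orb h i)).mul (continuous_orbD h h₁ i)).congr fun _ => rfl

theorem continuous_orbSumDD (h : Continuous φ) (h₁ : Continuous φ₁) (h₂ : Continuous φ₂) (q : ℕ) :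
    Continuous (uncurry (orbSumDD φ φ₁ φ₂ q)) :=
  (continuous_finsetSum (Finset.range q) fun i _ =>
    (((h₂.comp (continuous_orb h i)).mul (continuous_orbD h h₁ i)).mul
      (continuous_orbD h h₁ i)).add
      ((h₁.comp (continuous_orb h i)).mul (continuous_orbDD h h₁ h₂ i))).congr fun _ => rfl

end Orbit

/-- An open condition on the values of a continuous function, holding along a compact set for one
parameter, persists for nearby parameters. -/
theorem eventually_forall_mem_of_isCompact {F : ℝ × ℝ → ℝ → ℝ} (hF : Continuous (uncurry F))
    {K : Set ℝ} (hK : IsCompact K) {U : Set ℝ} (hU : IsOpen U) {v₀ : ℝ × ℝ}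
    (h : ∀ x ∈ K, F v₀ x ∈ U) : ∀ᶠ v in 𝓝 v₀, ∀ x ∈ K, F v x ∈ U :=
  hK.eventually_forall_of_forall_eventually fun x hx =>
    hF.continuousAt.eventually (hU.mem_nhds (h x hx))

/-! ## Criteria for bounds on the infinitesimal cyclicity

Here `φ = f / 2π`, read in the coordinate in which the circle has length one. -/

section Criteria

variable {f : Circle2Pi → ℝ} {φ φ₁ φ₂ : ℝ → ℝ}

/-! ### Periodicity and a priori control of the parameters. -/

theorem periodic_of_eq_cover (hφ : ∀ x, φ x = f (cover x) / (2 * Real.pi)) : Periodic φ 1 :=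
  fun x => by
    have := cover_add_int x 1
    push_cast at this
    rw [hφ, hφ, this]

theorem periodic_of_hasDerivAt (hp : Periodic φ 1) (h₁ : ∀ x, HasDerivAt φ (φ₁ x) x) :
    Periodic φ₁ 1 := fun x => by
  have h := (h₁ (x + 1)).comp_add_const x 1
  have h' : (fun y => φ (y + 1)) = φ := funext hp
  rw [h'] at h
  exact h.unique (h₁ x)

theorem exists_abs_le_of_periodic (hp : Periodic φ 1) (hc : Continuous φ) :
    ∃ M, 0 ≤ M ∧ ∀ x, |φ x| ≤ M := by
  obtain ⟨M, hM⟩ := (hp.isBounded_of_continuous one_ne_zero hc).exists_norm_le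
  exact ⟨M, (norm_nonneg _).trans (hM _ ⟨0, rfl⟩), fun x => hM _ ⟨x, rfl⟩⟩

theorem continuous_circleMap (hφ : ∀ x, φ x = f (cover x) / (2 * Real.pi)) (hc : Continuous φ)
    (r a : ℝ) : Continuous (circleMap f r a) := by
  have hq : IsQuotientMap cover :=
    ((QuotientAddGroup.isOpenMap_coe).comp
      (Homeomorph.mulLeft₀ (2 * Real.pi) Real.two_pi_pos.ne').isOpenMap).isQuotientMap
      continuous_cover cover_surjective
  have hf : Continuous f := by
    rw [hq.continuous_iff]
    refine (hc.const_mul (2 * Real.pi)).congr fun x => ?_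
    rw [hφ, mul_div_cancel₀ _ Real.two_pi_pos.ne', comp_apply]
  exact continuous_id.add ((AddCircle.continuous_mk' _).comp (by fun_prop))

/-- With the rotation number prescribed, `a → 0` forces `r` to tend to it, so only a neighbourhood
of one point of the parameter plane matters. -/
theorem abs_sub_translationNumber_le {M : ℝ}
    (hM : ∀ x, |φ x| ≤ M) {L : CircleDeg1Lift} {r a : ℝ}
    (hL : ∀ x, L x = x + r + a * φ x) : |r - L.translationNumber| ≤ |a| * M := by
  have hb : ∀ x, |a * φ x| ≤ |a| * M := fun x => by
    rw [abs_mul]; exact mul_le_mul_of_nonneg_left (hM x) (abs_nonneg a)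
  have h1 := L.translationNumber_le_of_le_add (z := r + |a| * M) fun x => by
    rw [hL]; linarith [(abs_le.1 (hb x)).2]
  have h2 := L.le_translationNumber_of_add_le (z := r - |a| * M) fun x => by
    rw [hL]; linarith [(abs_le.1 (hb x)).1]
  rw [abs_le]
  constructor <;> linarith

theorem eq_mul_phi (hφ : ∀ x, φ x = f (cover x) / (2 * Real.pi)) {L : CircleDeg1Lift} {r a : ℝ}
    (hL : ∀ x : ℝ, L x = x + r + a / (2 * Real.pi) * f ((2 * Real.pi * x : ℝ) : Circle2Pi))
    (x : ℝ) : L x = x + r + a * φ x := by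
  rw [hL, hφ, cover]; ring

/-- The cyclicity also ranges over `a = 0`, where the map is a rational rotation: its `q`-th iterate
is the identity, and no point attracts others. -/
theorem not_attracting_of_zero {r : ℝ} {p : ℤ} {q : ℕ} (hr : (q : ℝ) * r = p) (hq : 0 < q)
    {x : Circle2Pi} (hx : IsAttractingPeriodicPt (circleMap f r 0) x) : False := by
  have hs : Semiconj cover (fun x => x + r) (circleMap f r 0) :=
    semiconj_cover_circleMap fun x => by simp
  have hit : ∀ (n : ℕ) (y : ℝ), (fun x : ℝ => x + r)^[n] y = y + n * r := fun n y => by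
    rw [add_right_iterate_apply]; simp
  have hqid : ∀ θ, (circleMap f r 0)^[q] θ = θ := fun θ => by
    obtain ⟨y, rfl⟩ := cover_surjective θ
    rw [← (hs.iterate_right q) y, hit, hr, cover_add_int]
  obtain ⟨V, hV, hVt⟩ := hx.2.2
  set n := minimalPeriod (circleMap f r 0) x
  have hper : ∀ y ∈ V, y = x := fun y hy => by
    have h1 := (hVt y hy).comp (tendsto_atTop_mono (fun k => Nat.le_mul_of_pos_right k hq) tendsto_id)
    refine tendsto_nhds_unique (tendsto_const_nhds.congr fun k => ?_) h1
    simp only [comp_apply]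
    rw [← iterate_mul, show n * (k * q) = q * (n * k) by ring, iterate_mul]
    have : (circleMap f r 0)^[q] = id := funext hqid
    rw [this, iterate_id, id]
  obtain ⟨x, rfl⟩ := cover_surjective x
  have h1 : ∀ᶠ z in 𝓝[>] x, z ∈ Set.Ioo x (x + 1) ∧ cover z ∈ V :=
    Filter.Eventually.and (Ioo_mem_nhdsGT (by linarith))
      (nhdsWithin_le_nhds (continuous_cover.continuousAt.preimage_mem_nhds hV))
  obtain ⟨z, hz, hzV⟩ := h1.exists
  obtain ⟨k, rfl⟩ := cover_eq_cover_iff.1 (hper _ hzV).symm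
  have h2 : 0 < k := by
    have : (0 : ℝ) < k := by linarith [hz.1]
    exact_mod_cast this
  have h3 : k < 1 := by
    have : (k : ℝ) < 1 := by linarith [hz.2]
    exact_mod_cast this
  omega

/-- Three zeros are excluded on an interval where the first or the second derivative of a function
has no zeros. -/
theorem no_three_zeros {S S₁ S₂ : ℝ → ℝ} (h₁ : ∀ x, HasDerivAt S (S₁ x) x)
    (h₂ : ∀ x, HasDerivAt S₁ (S₂ x) x) {a b c x y z : ℝ} (hx : a ≤ x) (hxy : x < y) (hyz : y < z)
    (hz : z ≤ b) (hSx : S x = c) (hSy : S y = c) (hSz : S z = c)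
    (h : (∀ w ∈ Set.Icc a b, S₂ w ≠ 0) ∨ (∀ w ∈ Set.Icc a b, S₁ w ≠ 0)) : False := by
  obtain ⟨u, hu, hu0⟩ := exists_hasDerivAt_eq_zero hxy
    (fun w _ => (h₁ w).continuousAt.continuousWithinAt) (hSx.trans hSy.symm) fun w _ => h₁ w
  obtain ⟨v, hv, hv0⟩ := exists_hasDerivAt_eq_zero hyz
    (fun w _ => (h₁ w).continuousAt.continuousWithinAt) (hSy.trans hSz.symm) fun w _ => h₁ w
  rcases h with h | h
  · obtain ⟨w, hw, hw0⟩ := exists_hasDerivAt_eq_zero (hu.2.trans hv.1)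
      (fun w _ => (h₂ w).continuousAt.continuousWithinAt) (hu0.trans hv0.symm) fun w _ => h₂ w
    exact h w ⟨by linarith [hw.1, hu.1], by linarith [hw.2, hv.2]⟩ hw0
  · exact h u ⟨by linarith [hu.1], by linarith [hu.2]⟩ hu0

/-- On the arc of length `1/(4q)` centred at `j/(4q)` the argument stays within `π/2` of `j π`. The
sign of this cosine, equal to `2 cos² (2πqx) - 1`, decides which derivative of the averaged function
is bounded away from zero. -/
theorem cos_nonneg_or_nonpos {q : ℕ} (hq : 0 < q) (j : ℤ) :
    (∀ x ∈ Set.Icc ((j - 1 / 2 : ℝ) / (4 * q)) ((j + 1 / 2 : ℝ) / (4 * q)),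
      0 ≤ Real.cos (4 * Real.pi * q * x)) ∨
    (∀ x ∈ Set.Icc ((j - 1 / 2 : ℝ) / (4 * q)) ((j + 1 / 2 : ℝ) / (4 * q)),
      Real.cos (4 * Real.pi * q * x) ≤ 0) := by
  have hq' : (0 : ℝ) < 4 * q := by positivity
  have key : ∀ x ∈ Set.Icc ((j - 1 / 2 : ℝ) / (4 * q)) ((j + 1 / 2 : ℝ) / (4 * q)),
      0 ≤ Real.cos (4 * Real.pi * q * x - j * Real.pi) := fun x hx => by
    have h1 := (div_le_iff₀ hq').1 hx.1
    have h2 := (le_div_iff₀ hq').1 hx.2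
    have hpi := Real.pi_pos
    apply Real.cos_nonneg_of_neg_pi_div_two_le_of_le <;> nlinarith
  rcases Int.even_or_odd j with he | ho
  · left
    intro x hx
    have := key x hx
    rwa [Real.cos_sub_int_mul_pi, he.neg_one_zpow, one_mul] at this
  · right
    intro x hx
    have := key x hx
    rw [Real.cos_sub_int_mul_pi, ho.neg_one_zpow] at this
    linarith

/-- At most one attracting point of period `q` lies on an arc on which the first or the second
derivative of the sum along orbits has no zeros, so there are at most `4 q` of them. -/
theorem numAttractingTrajectories_le_four (hφ : ∀ x, φ x = f (cover x) / (2 * Real.pi))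
    (h₁ : ∀ x, HasDerivAt φ (φ₁ x) x) (h₂ : ∀ x, HasDerivAt φ₁ (φ₂ x) x)
    {p : ℤ} {q : ℕ} (hq : 0 < q) (hpq : IsCoprime p (q : ℤ)) {L : CircleDeg1Lift} {r a : ℝ}
    (hL : ∀ x, L x = x + r + a * φ x) (hρ : L.translationNumber = p / q) (ha : a ≠ 0)
    (hgood : ∀ j ∈ Finset.Ico (0 : ℤ) (4 * q),
      (∀ x ∈ Set.Icc ((j - 1 / 2 : ℝ) / (4 * q)) ((j + 1 / 2 : ℝ) / (4 * q)),
        orbSumDD φ φ₁ φ₂ q (r, a) x ≠ 0) ∨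
      (∀ x ∈ Set.Icc ((j - 1 / 2 : ℝ) / (4 * q)) ((j + 1 / 2 : ℝ) / (4 * q)),
        orbSumD φ φ₁ q (r, a) x ≠ 0)) :
    numAttractingTrajectories (circleMap f r a) ≤ 4 := by
  have hφc : Continuous φ := continuous_iff_continuousAt.2 fun x => (h₁ x).continuousAt
  have hLc : Continuous L := by
    have : (L : ℝ → ℝ) = fun x => x + r + a * φ x := funext hL
    rw [this]; fun_prop
  have hs : Semiconj cover L (circleMap f r a) := semiconj_cover_circleMap fun x => by
    rw [hL, hφ]; ring
  have hper : ∀ x, x ∈ periodicPts (circleMap f r a) → minimalPeriod (circleMap f r a) x = q :=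
    fun x hx => by
      obtain ⟨x, rfl⟩ := cover_surjective x
      exact (minimalPeriod_of_rotationNumber hs hq hpq hρ hx).1
  refine numAttractingTrajectories_le (continuous_circleMap hφ hφc r a) hq
    (fun x hx => hper x hx.1) (N := 4) ?_
  have hq' : (0 : ℝ) < 4 * q := by positivity
  -- Half the length of an arc: with representatives in `[-c, 1 - c)` the arcs `j = 0, …, 4q - 1`
  -- cover each point of the circle.
  set c : ℝ := 1 / 2 / (4 * q)
  set ℓ : Circle2Pi → ℝ := fun θ => Int.fract (surjInv cover_surjective θ + c) - c
  have hℓ : ∀ θ, cover (ℓ θ) = θ := fun θ => by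
    conv_rhs => rw [← surjInv_eq cover_surjective θ]
    rw [cover_eq_cover_iff]
    exact ⟨⌊surjInv cover_surjective θ + c⌋, by simp only [ℓ, Int.fract]; ring⟩
  have hfl : ∀ θ, 4 * q * ℓ θ + 1 / 2 = 4 * q * Int.fract (surjInv cover_surjective θ + c) :=
    fun θ => by simp only [ℓ, c]; field_simp; ring
  set idx : Circle2Pi → ℤ := fun θ => ⌊4 * q * ℓ θ + 1 / 2⌋
  have hidx : ∀ θ, idx θ ∈ Finset.Ico (0 : ℤ) (4 * q) := fun θ => by
    rw [Finset.mem_Ico]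
    simp only [idx, hfl]
    refine ⟨Int.floor_nonneg.2 (by positivity), Int.floor_lt.2 ?_⟩
    push_cast
    exact mul_lt_of_lt_one_right hq' (Int.fract_lt_one _)
  have harc : ∀ θ, ℓ θ ∈
      Set.Icc ((idx θ - 1 / 2 : ℝ) / (4 * q)) ((idx θ + 1 / 2 : ℝ) / (4 * q)) := fun θ => by
    have h1 := Int.floor_le (4 * q * ℓ θ + 1 / 2)
    have h2 := (Int.lt_floor_add_one (4 * q * ℓ θ + 1 / 2)).le
    rw [Set.mem_Icc, div_le_iff₀ hq', le_div_iff₀ hq']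
    simp only [idx]
    constructor <;> linarith
  have hcard : ((Finset.Ico (0 : ℤ) (4 * q) : Finset ℤ) : Set ℤ).encard = (4 : ℕ) * q := by
    have h4 : (4 * (q : ℤ) - 0).toNat = 4 * q := by omega
    rw [Set.encard_coe_eq_coe_finsetCard, Int.card_Ico, h4]
    push_cast; rfl
  rw [← hcard]
  refine Set.encard_le_encard_of_injOn (f := idx) (fun θ _ => hidx θ) ?_
  -- two attracting points on the same arc
  have key : ∀ x y : ℝ, ∀ j ∈ Finset.Ico (0 : ℤ) (4 * q), x < y →
      (j - 1 / 2 : ℝ) / (4 * q) ≤ x → y ≤ (j + 1 / 2 : ℝ) / (4 * q) →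
      (minimalPeriod (circleMap f r a) (cover x) = q ∧
        AttractsNhd (circleMap f r a)^[q] (cover x)) →
      (minimalPeriod (circleMap f r a) (cover y) = q ∧
        AttractsNhd (circleMap f r a)^[q] (cover y)) → False := by
    intro x y j hj hxy hjx hyj hax hay
    have hmem : ∀ θ, minimalPeriod (circleMap f r a) θ = q → θ ∈ periodicPts (circleMap f r a) :=
      fun θ h => minimalPeriod_pos_iff_mem_periodicPts.1 (by rw [h]; exact hq)
    have hfx := (minimalPeriod_of_rotationNumber hs hq hpq hρ (hmem _ hax.1)).2
    have hfy := (minimalPeriod_of_rotationNumber hs hq hpq hρ (hmem _ hay.1)).2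
    have hlen : y < x + 1 := by
      have h1 : (j + 1 / 2 : ℝ) / (4 * q) = (j - 1 / 2 : ℝ) / (4 * q) + 1 / (4 * q) := by ring
      have h2 : 1 / (4 * q : ℝ) < 1 := by
        rw [div_lt_one hq']
        have : (1 : ℝ) ≤ q := by exact_mod_cast hq
        linarith
      linarith
    -- Two attracting points enclose a third fixed point, so the orbit sum takes the value `(p - q
    -- r) / a` three times on one arc.
    obtain ⟨z, hz, hfz⟩ := exists_fixed_between (G := fun t => L^[q] t - p)
      (fun s t hst => sub_le_sub_right (L.monotone.iterate q hst) _)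
      ((hLc.iterate q).sub continuous_const)
      (g := (circleMap f r a)^[q]) (fun t => by
        rw [cover_sub_int]; exact (hs.iterate_right q) t) hxy hlen
      (by linarith) (by linarith) hax.2 hay.2
    have hzero : ∀ t, L^[q] t = t + p → orbSum φ q (r, a) t = (p - q * r) / a := fun t ht => by
      rw [← orb_eq_iterate (φ := φ) L (r, a) hL, orb_eq_add_orbSum] at ht
      simp only at ht
      rw [eq_div_iff ha]; linarith
    exact no_three_zeros (hasDerivAt_orbSum h₁ q (r, a)) (hasDerivAt_orbSumD h₁ h₂ q (r, a))
      hjx hz.1 hz.2 hyj (hzero _ hfx) (hzero _ (by simpa [sub_eq_iff_eq_add] using hfz))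
      (hzero _ hfy) (hgood j hj)
  intro θ hθ θ' hθ' heq
  have hne : ℓ θ = ℓ θ' := by
    have h1 := harc θ
    have h2 := harc θ'
    rw [← heq] at h2
    have hθ2 := hθ
    have hθ2' := hθ'
    rw [← hℓ θ] at hθ2
    rw [← hℓ θ'] at hθ2'
    rcases lt_trichotomy (ℓ θ) (ℓ θ') with h | h | h
    · exact (key _ _ _ (hidx θ) h h1.1 h2.2 hθ2 hθ2').elim
    · exact h
    · exact (key _ _ _ (hidx θ) h h2.1 h1.2 hθ2' hθ2).elim
  rw [← hℓ θ, hne, hℓ]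

/-- Upper bound for the infinitesimal cyclicity. -/
theorem infinitesimalCyclicity_le_four (hφ : ∀ x, φ x = f (cover x) / (2 * Real.pi))
    (h₁ : ∀ x, HasDerivAt φ (φ₁ x) x) (h₂ : ∀ x, HasDerivAt φ₁ (φ₂ x) x) (hc : Continuous φ₂)
    (hcond : ∀ (p : ℤ) (q : ℕ), 0 < q → IsCoprime p (q : ℤ) → ∀ x : ℝ,
      (0 ≤ Real.cos (4 * Real.pi * q * x) →
        ∑ i ∈ Finset.range q, φ₂ (x + i * ((p : ℝ) / q)) ≠ 0) ∧
      (Real.cos (4 * Real.pi * q * x) ≤ 0 →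
        ∑ i ∈ Finset.range q, φ₁ (x + i * ((p : ℝ) / q)) ≠ 0)) (ρ : ℝ) :
    infinitesimalCyclicity f ρ ≤ 4 := by
  have hφc : Continuous φ := continuous_iff_continuousAt.2 fun x => (h₁ x).continuousAt
  have hφ₁c : Continuous φ₁ := continuous_iff_continuousAt.2 fun x => (h₂ x).continuousAt
  suffices h : ∃ ε > 0, ∀ r a, HasRotationNumber f r a ρ → |a| < ε →
      numAttractingTrajectories (circleMap f r a) ≤ 4 by
    obtain ⟨ε, hε, h⟩ := h
    refine limsup_le_of_le (by isBoundedDefault) ?_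
    filter_upwards [Ioo_mem_nhdsGT hε] with a₁ ha₁
    exact iSup_le fun r => iSup_le fun a => iSup_le fun hrot => iSup_le fun ha =>
      h r a hrot (ha.trans ha₁.2)
  have hempty : ∀ g : Circle2Pi → Circle2Pi, (∀ x, ¬ IsAttractingPeriodicPt g x) →
      numAttractingTrajectories g ≤ 4 := fun g hg => by
    have : {O : Set Circle2Pi | ∃ x, IsAttractingPeriodicPt g x ∧
        O = Set.range (fun n : ℕ => g^[n] x)} = ∅ :=
      Set.eq_empty_of_forall_notMem fun O ⟨x, hx, _⟩ => hg x hx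
    rw [numAttractingTrajectories, this, Set.encard_empty]
    exact zero_le
  by_cases hrat : ∃ c : ℚ, ρ = c
  · obtain ⟨c, rfl⟩ := hrat
    set p := c.num
    set q := c.den
    have hq : 0 < q := c.den_pos
    have hpq : IsCoprime p (q : ℤ) := Int.isCoprime_iff_gcd_eq_one.2 c.reduced
    have hcpq : (c : ℝ) = p / q := Rat.cast_def c
    -- At `a = 0` the orbit sums are sums over a rational rotation; nonvanishing on the finitely
    -- many compact arcs is an open condition on `(r, a)`.
    have hgood : ∀ᶠ v in 𝓝 ((p / q : ℝ), (0 : ℝ)), ∀ j ∈ Finset.Ico (0 : ℤ) (4 * q),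
        (∀ x ∈ Set.Icc ((j - 1 / 2 : ℝ) / (4 * q)) ((j + 1 / 2 : ℝ) / (4 * q)),
          orbSumDD φ φ₁ φ₂ q v x ≠ 0) ∨
        (∀ x ∈ Set.Icc ((j - 1 / 2 : ℝ) / (4 * q)) ((j + 1 / 2 : ℝ) / (4 * q)),
          orbSumD φ φ₁ q v x ≠ 0) := by
      rw [Filter.eventually_all_finset]
      intro j _
      have hU : IsOpen ({0}ᶜ : Set ℝ) := isOpen_compl_singleton
      rcases cos_nonneg_or_nonpos hq j with hj | hj
      · filter_upwards [eventually_forall_mem_of_isCompact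
          (continuous_orbSumDD hφc hφ₁c hc q) isCompact_Icc hU (fun x hx => by
            rw [orbSumDD_zero_right]; exact (hcond p q hq hpq x).1 (hj x hx))] with v hv
        exact Or.inl hv
      · filter_upwards [eventually_forall_mem_of_isCompact
          (continuous_orbSumD hφc hφ₁c q) isCompact_Icc hU (fun x hx => by
            rw [orbSumD_zero_right]; exact (hcond p q hq hpq x).2 (hj x hx))] with v hv
        exact Or.inr hv
    obtain ⟨ε, hε, hball⟩ := Metric.eventually_nhds_iff.1 hgood
    obtain ⟨M, hM0, hM⟩ := exists_abs_le_of_periodic (periodic_of_eq_cover hφ) hφc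
    -- This bound makes both `|a|` and `|r - p/q| ≤ |a| M` smaller than `ε`.
    refine ⟨ε / (M + 1), by positivity, ?_⟩
    rintro r a ⟨L, hL, hρ⟩ ha
    have hL' := eq_mul_phi hφ hL
    rw [lt_div_iff₀ (by positivity)] at ha
    have habs := abs_nonneg a
    have hM2 : 0 ≤ |a| * M := by positivity
    have hr := abs_sub_translationNumber_le hM hL'
    rw [hρ, hcpq] at hr
    rcases eq_or_ne a 0 with rfl | ha0
    · simp only [abs_zero, zero_mul] at hr
      have hr' : r = p / q := by
        rw [← sub_eq_zero]; exact abs_nonpos_iff.1 hr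
      refine hempty _ fun x hx => not_attracting_of_zero (p := p) (q := q) ?_ hq hx
      rw [hr']; field_simp
    · refine numAttractingTrajectories_le_four hφ h₁ h₂ hq hpq hL' (hρ.trans hcpq) ha0
        (hball ?_)
      rw [Prod.dist_eq, max_lt_iff, Real.dist_eq, Real.dist_eq]
      constructor
      · linarith
      · rw [sub_zero]; linarith
  · refine ⟨1, one_pos, ?_⟩
    -- An irrational rotation number excludes periodic points altogether.
    rintro r a ⟨L, hL, hρ⟩ -
    refine hempty _ fun x hx => hrat ?_
    obtain ⟨x, rfl⟩ := cover_surjective x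
    have hs : Semiconj cover L (circleMap f r a) := semiconj_cover_circleMap hL
    have hn := minimalPeriod_pos_of_mem_periodicPts hx.1
    obtain ⟨m, hm⟩ := exists_iterate_eq_of_isPeriodicPt hs
      (isPeriodicPt_minimalPeriod (circleMap f r a) (cover x))
    refine ⟨(m : ℚ) / (minimalPeriod (circleMap f r a) (cover x) : ℕ), ?_⟩
    rw [← hρ, rotationNumber_of_iterate hn hm]
    push_cast; rfl

/-- Lower bound for the infinitesimal cyclicity at `1 / q`. -/
theorem le_infinitesimalCyclicity (hφ : ∀ x, φ x = f (cover x) / (2 * Real.pi))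
    (h₁ : ∀ x, HasDerivAt φ (φ₁ x) x) (hc : Continuous φ₁) {q N : ℕ} (hq : 0 < q) (c : ℝ)
    (hl : ∀ k < N * q, c <
      ∑ i ∈ Finset.range q, φ ((k + 1 / 8) / (N * q : ℕ) + i * (1 / q : ℝ)))
    (hu : ∀ k < N * q,
      ∑ i ∈ Finset.range q, φ ((k + 3 / 8) / (N * q : ℕ) + i * (1 / q : ℝ)) < c)
    (hd : ∀ k < N * q, ∀ x ∈ Set.Icc ((k + 1 / 8 : ℝ) / (N * q : ℕ)) ((k + 3 / 8) / (N * q : ℕ)),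
      ∑ i ∈ Finset.range q, φ₁ (x + i * (1 / q : ℝ)) < 0) :
    (N : ℕ∞) ≤ infinitesimalCyclicity f (1 / q) := by
  have hφc : Continuous φ := continuous_iff_continuousAt.2 fun x => (h₁ x).continuousAt
  obtain ⟨M₁, hM₁0, hM₁⟩ := exists_abs_le_of_periodic
    (periodic_of_hasDerivAt (periodic_of_eq_cover hφ) h₁) hc
  have hgood : ∀ᶠ v in 𝓝 ((1 / q : ℝ), (0 : ℝ)), ∀ k ∈ Finset.range (N * q),
      c < orbSum φ q v ((k + 1 / 8) / (N * q : ℕ)) ∧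
      orbSum φ q v ((k + 3 / 8) / (N * q : ℕ)) < c ∧
      ∀ x ∈ Set.Icc ((k + 1 / 8 : ℝ) / (N * q : ℕ)) ((k + 3 / 8) / (N * q : ℕ)),
        orbSumD φ φ₁ q v x < 0 := by
    rw [Filter.eventually_all_finset]
    intro k hk
    rw [Finset.mem_range] at hk
    have e1 := eventually_forall_mem_of_isCompact (v₀ := ((1 / q : ℝ), (0 : ℝ)))
      (continuous_orbSum hφc q) (isCompact_singleton (x := ((k : ℝ) + 1 / 8) / (N * q : ℕ)))
      (isOpen_Ioi (a := c)) (fun x hx => by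
        rw [Set.mem_singleton_iff.1 hx, orbSum_zero_right]; exact hl k hk)
    have e2 := eventually_forall_mem_of_isCompact (v₀ := ((1 / q : ℝ), (0 : ℝ)))
      (continuous_orbSum hφc q) (isCompact_singleton (x := ((k : ℝ) + 3 / 8) / (N * q : ℕ)))
      (isOpen_Iio (a := c)) (fun x hx => by
        rw [Set.mem_singleton_iff.1 hx, orbSum_zero_right]; exact hu k hk)
    have e3 := eventually_forall_mem_of_isCompact (v₀ := ((1 / q : ℝ), (0 : ℝ)))
      (continuous_orbSumD hφc hc q)
      (isCompact_Icc (a := ((k : ℝ) + 1 / 8) / (N * q : ℕ)) (b := ((k : ℝ) + 3 / 8) / (N * q : ℕ)))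
      (isOpen_Iio (a := (0 : ℝ))) (fun x hx => by
        rw [orbSumD_zero_right]; exact hd k hk x hx)
    filter_upwards [e1, e2, e3] with v v1 v2 v3
    exact ⟨v1 _ rfl, v2 _ rfl, v3⟩
  -- On this curve in the parameter plane the `q`-th iterate minus `1` is `t + a (orbSum - c)`, so
  -- the fixed points are the points of the level `c`; descending crossings are attracting for `a >
  -- 0`.
  have hcurve : Tendsto (fun a : ℝ => ((1 / q - a * c / q : ℝ), a)) (𝓝[>] 0)
      (𝓝 ((1 / q : ℝ), (0 : ℝ))) := by
    refine Tendsto.mono_left ?_ nhdsWithin_le_nhds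
    have : Continuous fun a : ℝ => ((1 / q - a * c / q : ℝ), a) := by fun_prop
    simpa using this.tendsto 0
  refine le_limsup_of_frequently_le (Eventually.frequently ?_) (by isBoundedDefault)
  filter_upwards [self_mem_nhdsWithin] with a₁ ha₁
  have hsmall : ∀ᶠ a : ℝ in 𝓝[>] 0, a ∈ Set.Ioo 0 (min a₁ (1 / (M₁ + 1))) :=
    Ioo_mem_nhdsGT (lt_min ha₁ (by positivity))
  obtain ⟨a, hgood, ha⟩ := ((hcurve.eventually hgood).and hsmall).exists
  have ha0 : 0 < a := ha.1
  have haM : a * M₁ ≤ 1 := by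
    have h1 := ha.2.trans_le (min_le_right _ _)
    rw [lt_div_iff₀ (by positivity)] at h1
    linarith
  set r : ℝ := 1 / q - a * c / q with hr
  rcases Nat.eq_zero_or_pos N with rfl | hN
  · exact zero_le
  have hqR : (0 : ℝ) < q := by exact_mod_cast hq
  have hNq : (0 : ℝ) < (N * q : ℕ) := by exact_mod_cast Nat.mul_pos hN hq
  -- the lift
  have hLd : ∀ x, HasDerivAt (fun x => x + r + a * φ x) (1 + a * φ₁ x) x := fun x =>
    ((hasDerivAt_id x).add_const r).add ((h₁ x).const_mul a)
  have hLmono : Monotone fun x => x + r + a * φ x :=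
    monotone_of_deriv_nonneg (fun x => (hLd x).differentiableAt) fun x => by
      rw [(hLd x).deriv]
      have h2 : a * |φ₁ x| ≤ a * M₁ := mul_le_mul_of_nonneg_left (hM₁ x) ha0.le
      have h3 : -(a * |φ₁ x|) ≤ a * φ₁ x := by
        rw [← mul_neg]; exact mul_le_mul_of_nonneg_left (neg_abs_le _) ha0.le
      linarith
  set L : CircleDeg1Lift := ⟨⟨fun x => x + r + a * φ x, hLmono⟩, fun x => by
    simp only
    rw [periodic_of_eq_cover hφ x]; ring⟩
  have hL : ∀ x, L x = x + r + a * φ x := fun x => rfl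
  have hLc : Continuous L := by
    have : (L : ℝ → ℝ) = fun x => x + r + a * φ x := funext hL
    rw [this]; fun_prop
  have hs : Semiconj cover L (circleMap f r a) := semiconj_cover_circleMap fun x => by
    rw [hL, hφ]; ring
  have hLq : ∀ t, L^[q] t - (1 : ℤ) = t + a * (orbSum φ q (r, a) t - c) := fun t => by
    rw [← orb_eq_iterate (φ := φ) L (r, a) hL, orb_eq_add_orbSum]
    simp only [hr]; push_cast; field_simp; ring
  -- the attracting points
  have hpt : ∀ k < N * q, ∃ x ∈ Set.Ioo ((k + 1 / 8 : ℝ) / (N * q : ℕ)) ((k + 3 / 8) / (N * q : ℕ)),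
      L^[q] x - (1 : ℤ) = x ∧
      (∀ z ∈ Set.Ico ((k + 1 / 8 : ℝ) / (N * q : ℕ)) x, z < L^[q] z - (1 : ℤ)) ∧
      (∀ z ∈ Set.Ioc x ((k + 3 / 8 : ℝ) / (N * q : ℕ)), L^[q] z - (1 : ℤ) < z) := fun k hk => by
    obtain ⟨g1, g2, g3⟩ := hgood k (Finset.mem_range.2 hk)
    have hlt : (k + 1 / 8 : ℝ) / (N * q : ℕ) < (k + 3 / 8) / (N * q : ℕ) := by
      apply div_lt_div_of_pos_right _ hNq; linarith
    have hSc : Continuous (orbSum φ q (r, a)) :=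
      continuous_iff_continuousAt.2 fun x => (hasDerivAt_orbSum h₁ q (r, a) x).continuousAt
    have hanti : StrictAntiOn (orbSum φ q (r, a))
        (Set.Icc ((k + 1 / 8 : ℝ) / (N * q : ℕ)) ((k + 3 / 8) / (N * q : ℕ))) := by
      refine strictAntiOn_of_deriv_neg (convex_Icc _ _) hSc.continuousOn fun x hx => ?_
      rw [(hasDerivAt_orbSum h₁ q (r, a) x).deriv]
      exact g3 x (interior_subset hx)
    obtain ⟨x, hx, hxc⟩ := intermediate_value_Ioo' hlt.le hSc.continuousOn ⟨g2, g1⟩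
    refine ⟨x, hx, ?_, fun z hz => ?_, fun z hz => ?_⟩
    · rw [hLq, hxc]; ring
    · rw [hLq]
      have := hanti ⟨hz.1, hz.2.le.trans hx.2.le⟩ ⟨hx.1.le, hx.2.le⟩ hz.2
      rw [hxc] at this
      have := mul_pos ha0 (sub_pos.2 this)
      linarith
    · rw [hLq]
      have := hanti ⟨hx.1.le, hx.2.le⟩ ⟨hx.1.le.trans hz.1.le, hz.2⟩ hz.1
      rw [hxc] at this
      have := mul_pos ha0 (sub_pos.2 this)
      linarith
  choose! s hs1 hs2 hs3 hs4 using hpt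
  -- The rotation number need not be prescribed in advance: the fixed points just found determine
  -- it.
  have hρ : L.translationNumber = 1 / q := by
    have := rotationNumber_of_iterate hq (L := L) (x := s 0) (p := 1)
      (by linarith [hs2 0 (Nat.mul_pos hN hq)])
    simpa using this
  have hrot : HasRotationNumber f r a (1 / q) := by
    refine ⟨L, fun x => ?_, hρ⟩
    rw [hL, hφ, cover]; ring
  refine le_trans ?_ (le_iSup₂_of_le r a (le_iSup₂_of_le hrot
    (by rw [abs_of_pos ha0]; exact ha.2.trans_le (min_le_left _ _)) le_rfl))
  have hfix : ∀ k < N * q, (circleMap f r a)^[q] (cover (s k)) = cover (s k) := fun k hk => by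
    rw [← (hs.iterate_right q) (s k), show L^[q] (s k) = s k + (1 : ℤ) by linarith [hs2 k hk],
      cover_add_int]
  have hmem : ∀ k < N * q, cover (s k) ∈ periodicPts (circleMap f r a) := fun k hk =>
    ⟨q, hq, hfix k hk⟩
  have hmin : ∀ k < N * q, minimalPeriod (circleMap f r a) (cover (s k)) = q := fun k hk =>
    (minimalPeriod_of_rotationNumber (p := 1) hs hq isCoprime_one_left (by simpa using hρ)
      (hmem k hk)).1
  refine le_numAttractingTrajectories hq (fun k => cover (s k)) ?_ fun k hk => ⟨hmin k hk, ?_⟩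
  · intro k hk l hl' hkl
    obtain ⟨m, hm⟩ := cover_eq_cover_iff.1 hkl
    -- The `i`-th point lies strictly between `i / (N q)` and `(i + 1) / (N q)`, which makes the
    -- points distinct modulo the integers.
    have b : ∀ i < N * q, (i : ℝ) < (N * q : ℕ) * s i ∧ (N * q : ℕ) * s i < i + 1 := fun i hi => by
      have h1 := (div_lt_iff₀ hNq).1 (hs1 i hi).1
      have h2 := (lt_div_iff₀ hNq).1 (hs1 i hi).2
      constructor <;> linarith
    have b1 := b k hk
    have b2 := b l hl'
    rw [hm, mul_add] at b2
    have hk' : (k : ℝ) + 1 ≤ (N * q : ℕ) := by exact_mod_cast hk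
    have hl'' : (l : ℝ) + 1 ≤ (N * q : ℕ) := by exact_mod_cast hl'
    have hk0 : (0 : ℝ) ≤ k := Nat.cast_nonneg k
    have hl0 : (0 : ℝ) ≤ l := Nat.cast_nonneg l
    have hm1 : m < 1 := by
      by_contra! h
      have h' : (1 : ℝ) ≤ m := by exact_mod_cast h
      nlinarith
    have hm2 : -1 < m := by
      by_contra! h
      have h' : (m : ℝ) ≤ -1 := by exact_mod_cast h
      nlinarith
    obtain rfl : m = 0 := by omega
    simp only [Int.cast_zero, mul_zero, add_zero] at b2
    have c1 : (k : ℝ) < l + 1 := by linarith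
    have c2 : (l : ℝ) < k + 1 := by linarith
    have c3 : k < l + 1 := by exact_mod_cast c1
    have c4 : l < k + 1 := by exact_mod_cast c2
    omega
  · have hst := stable_of_sign_change (G := fun t => L^[q] t - (1 : ℤ))
      (fun s t hst => sub_le_sub_right (L.monotone.iterate q hst) _)
      ((hLc.iterate q).sub continuous_const)
      (g := (circleMap f r a)^[q]) (fun t => by
        rw [cover_sub_int]; exact (hs.iterate_right q) t) (hs1 k hk).1 (hs1 k hk).2 (hs2 k hk)
      (hs3 k hk) (hs4 k hk)
    refine ⟨hmem k hk, ?_⟩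
    rw [hmin k hk]
    exact hst

end Criteria

/-! ## The trigonometric system and lacunary series -/

/-- The frequency of the `m`-th trigonometric function in the list
`1, sin x, cos x, sin 2x, cos 2x, …`. -/
def freq (m : ℕ) : ℕ := (m + 1) / 2

/-- The phase of the `m`-th trigonometric function. -/
def phase (m : ℕ) : ℝ := if Even m then 0 else Real.pi / 2

/-- The derivative of order `d` of the `m`-th trigonometric function. -/
def wave (d m : ℕ) (x : ℝ) : ℝ :=
  (freq m : ℝ) ^ d * Real.cos (freq m * x - phase m + d * (Real.pi / 2))

theorem freq_two_mul (n : ℕ) : freq (2 * n) = n := by unfold freq; omega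

theorem phase_two_mul (n : ℕ) : phase (2 * n) = 0 := by simp [phase]

theorem freq_le (m : ℕ) : freq m ≤ m := by unfold freq; omega

theorem hasDerivAt_wave (d m : ℕ) (x : ℝ) : HasDerivAt (wave d m) (wave (d + 1) m x) x := by
  have h : HasDerivAt (fun x : ℝ => (freq m : ℝ) * x - phase m + d * (Real.pi / 2)) (freq m) x := by
    simpa using (((hasDerivAt_id x).const_mul (freq m : ℝ)).sub_const (phase m)).add_const
      (d * (Real.pi / 2))
  refine (h.cos.const_mul ((freq m : ℝ) ^ d)).congr_deriv ?_
  have : freq m * x - phase m + (d + 1 : ℕ) * (Real.pi / 2) =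
      (freq m * x - phase m + d * (Real.pi / 2)) + Real.pi / 2 := by push_cast; ring
  rw [wave, this, Real.cos_add_pi_div_two]
  ring

theorem continuous_wave (d m : ℕ) : Continuous (wave d m) :=
  continuous_iff_continuousAt.2 fun x => (hasDerivAt_wave d m x).continuousAt

theorem abs_wave_le (d m : ℕ) (x : ℝ) : |wave d m x| ≤ (freq m : ℝ) ^ d := by
  rw [wave, abs_mul, abs_of_nonneg (by positivity)]
  exact mul_le_of_le_one_right (by positivity) (Real.abs_cos_le_one _)

/-- The terms are real parts of a geometric progression whose ratio is a `q`-th root of unity. By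
coprimality the ratio is `1` only if `q ∣ n`; otherwise the sum vanishes. -/
theorem sum_cos_add_mul (p : ℤ) {q : ℕ} (hq : 0 < q) (hpq : IsCoprime p (q : ℤ)) (n : ℕ) (θ : ℝ) :
    ∑ i ∈ Finset.range q, Real.cos (θ + n * (i * (2 * Real.pi * (p / q)))) =
      if q ∣ n then q * Real.cos θ else 0 := by
  have hqR : (q : ℝ) ≠ 0 := by exact_mod_cast hq.ne'
  split_ifs with h
  · obtain ⟨k, rfl⟩ := h
    rw [Finset.sum_congr rfl (g := fun _ => Real.cos θ), Finset.sum_const, Finset.card_range,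
      nsmul_eq_mul]
    intro i _
    have : (θ + (q * k : ℕ) * (i * (2 * Real.pi * (p / q)))) =
        θ + ((k * i * p : ℤ) : ℝ) * (2 * Real.pi) := by
      push_cast; field_simp
    rw [this, Real.cos_add_int_mul_two_pi]
  · set w : ℂ := Complex.exp ((n * (2 * Real.pi * (p / q)) : ℝ) * Complex.I)
    have hwq : w ^ q = 1 := by
      rw [← Complex.exp_nat_mul, Complex.exp_eq_one_iff]
      refine ⟨n * p, ?_⟩
      have : (q : ℂ) ≠ 0 := by exact_mod_cast hq.ne'
      push_cast; field_simp
    have hw1 : w ≠ 1 := fun hw => by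
      rw [Complex.exp_eq_one_iff] at hw
      obtain ⟨k, hk⟩ := hw
      have h2 : ((n * (2 * Real.pi * (p / q)) : ℝ) : ℂ) = ((k * (2 * Real.pi) : ℝ) : ℂ) := by
        have hI := Complex.I_ne_zero
        apply mul_right_cancel₀ hI
        rw [hk]; push_cast; ring
      have h3 : (n * (2 * Real.pi * (p / q)) : ℝ) = k * (2 * Real.pi) := by exact_mod_cast h2
      have hpi := Real.pi_ne_zero
      field_simp at h3
      have h4 : (n : ℤ) * p = k * q := by
        have : (n : ℝ) * p = k * q := by linarith
        exact_mod_cast this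
      have h5 : (q : ℤ) ∣ n := hpq.symm.dvd_of_dvd_mul_right (Dvd.intro_left k h4.symm)
      exact h (Int.natCast_dvd_natCast.1 h5)
    have hsum : ∑ i ∈ Finset.range q, w ^ i = 0 := by
      rw [geom_sum_eq hw1, hwq, sub_self, zero_div]
    have hterm : ∀ i ∈ Finset.range q, Real.cos (θ + n * (i * (2 * Real.pi * (p / q)))) =
        (Complex.exp (θ * Complex.I) * w ^ i).re := fun i _ => by
      rw [← Complex.exp_nat_mul, ← Complex.exp_add, ← Complex.exp_ofReal_mul_I_re]
      congr 2
      push_cast; ring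
    rw [Finset.sum_congr rfl hterm, ← Complex.re_sum, ← Finset.mul_sum, hsum, mul_zero,
      Complex.zero_re]

theorem sum_wave_add (d m : ℕ) (p : ℤ) {q : ℕ} (hq : 0 < q) (hpq : IsCoprime p (q : ℤ)) (x : ℝ) :
    ∑ i ∈ Finset.range q, wave d m (x + i * (2 * Real.pi * (p / q))) =
      if q ∣ freq m then q * wave d m x else 0 := by
  have := sum_cos_add_mul p hq hpq (freq m) (freq m * x - phase m + d * (Real.pi / 2))
  have h2 : ∀ i ∈ Finset.range q, wave d m (x + i * (2 * Real.pi * (p / q))) = (freq m : ℝ) ^ d *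
      Real.cos (freq m * x - phase m + d * (Real.pi / 2) +
        freq m * (i * (2 * Real.pi * (p / q)))) := fun i _ => by
    rw [wave]; congr 2; ring
  rw [Finset.sum_congr rfl h2, ← Finset.mul_sum, this]
  split_ifs
  · rw [wave]; ring
  · rw [mul_zero]

/-- The derivative of order `d` of the series `∑ cⱼ e_{μ j}` in trigonometric functions. -/
def waveSeries (c : ℕ → ℝ) (μ : ℕ → ℕ) (d : ℕ) (x : ℝ) : ℝ :=
  ∑' j, c j * wave d (μ j) x

section Series

variable {c : ℕ → ℝ} {μ : ℕ → ℕ}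

theorem abs_mul_wave_le (d j : ℕ) (x : ℝ) :
    ‖c j * wave d (μ j) x‖ ≤ |c j| * (freq (μ j) : ℝ) ^ d := by
  rw [Real.norm_eq_abs, abs_mul]
  exact mul_le_mul_of_nonneg_left (abs_wave_le d (μ j) x) (abs_nonneg _)

theorem summable_mul_wave {d : ℕ} (h : Summable fun j => |c j| * (freq (μ j) : ℝ) ^ d) (x : ℝ) :
    Summable fun j => c j * wave d (μ j) x :=
  Summable.of_norm_bounded h fun j => abs_mul_wave_le d j x

theorem hasDerivAt_waveSeries {d : ℕ} (h : Summable fun j => |c j| * (freq (μ j) : ℝ) ^ d)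
    (h' : Summable fun j => |c j| * (freq (μ j) : ℝ) ^ (d + 1)) (x : ℝ) :
    HasDerivAt (waveSeries c μ d) (waveSeries c μ (d + 1) x) x :=
  hasDerivAt_tsum h' (fun j y => (hasDerivAt_wave d (μ j) y).const_mul (c j))
    (fun j y => abs_mul_wave_le (d + 1) j y) (summable_mul_wave h 0) x

theorem continuous_waveSeries {d : ℕ} (h : Summable fun j => |c j| * (freq (μ j) : ℝ) ^ d) :
    Continuous (waveSeries c μ d) :=
  continuous_tsum (fun j => continuous_const.mul (continuous_wave d (μ j))) h
    fun j y => abs_mul_wave_le d j y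

/-- The contribution of the constant function to `waveSeries`. -/
def waveConst (c : ℕ → ℝ) (μ : ℕ → ℕ) (d : ℕ) : ℝ :=
  ∑' j, if freq (μ j) = 0 then c j * wave d (μ j) 0 else 0

theorem wave_of_freq_eq_zero {m : ℕ} (h : freq m = 0) (d : ℕ) (x : ℝ) :
    wave d m x = wave d m 0 := by simp [wave, h]

theorem waveConst_succ (c : ℕ → ℝ) (μ : ℕ → ℕ) (d : ℕ) : waveConst c μ (d + 1) = 0 := by
  unfold waveConst
  refine (tsum_congr fun j => ?_).trans tsum_zero
  split_ifs with h
  · simp [wave, h]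
  · rfl

/-- Averaging a series over a rational rotation leaves the terms whose frequency is a multiple of
the denominator; if all of these apart from the constants and those indexed by `T` are small, so
is the remainder. -/
theorem abs_average_waveSeries_sub_le {d : ℕ}
    (h : Summable fun j => |c j| * (freq (μ j) : ℝ) ^ d) {p : ℤ} {q : ℕ} (hq : 0 < q)
    (hpq : IsCoprime p (q : ℤ)) (T : Finset ℕ) (hT : ∀ j ∈ T, q ∣ freq (μ j) ∧ freq (μ j) ≠ 0)
    {K : ℝ} (hK : 0 ≤ K) (hsmall : ∀ j ∉ T, q ∣ freq (μ j) → freq (μ j) ≠ 0 →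
      |c j| * (freq (μ j) : ℝ) ^ d ≤ K * (1 / 8) ^ (j + 1)) (x : ℝ) :
    |(∑ i ∈ Finset.range q, waveSeries c μ d (x + i * (2 * Real.pi * (p / q)))) / q -
      waveConst c μ d - ∑ j ∈ T, c j * wave d (μ j) x| ≤ K / 7 := by
  have hqR : (q : ℝ) ≠ 0 := by exact_mod_cast hq.ne'
  have hsum := fun y => summable_mul_wave h y
  -- Averaging commutes with the convergent series and acts termwise as the projection onto
  -- frequencies divisible by `q`.
  have havg : HasSum (fun j => if q ∣ freq (μ j) then c j * wave d (μ j) x else 0)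
      ((∑ i ∈ Finset.range q, waveSeries c μ d (x + i * (2 * Real.pi * (p / q)))) / q) := by
    have h1 := (hasSum_sum fun i (_ : i ∈ Finset.range q) =>
      (hsum (x + i * (2 * Real.pi * (p / q)))).hasSum).div_const (q : ℝ)
    refine h1.congr_fun fun j => ?_
    rw [← Finset.mul_sum, sum_wave_add d (μ j) p hq hpq]
    split_ifs
    · field_simp
    · simp
  have hconst : HasSum (fun j => if freq (μ j) = 0 then c j * wave d (μ j) 0 else 0)
      (waveConst c μ d) := by
    refine Summable.hasSum (Summable.of_norm_bounded h fun j => ?_)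
    split_ifs
    · exact abs_mul_wave_le d j 0
    · simp only [norm_zero]; positivity
  have hfin : HasSum (fun j => if j ∈ T then c j * wave d (μ j) x else 0)
      (∑ j ∈ T, c j * wave d (μ j) x) := by
    have : HasSum (fun j => if j ∈ T then c j * wave d (μ j) x else 0)
        (∑ j ∈ T, if j ∈ T then c j * wave d (μ j) x else 0) :=
      hasSum_sum_of_ne_finset_zero fun j hj => if_neg hj
    rwa [Finset.sum_congr rfl (fun j hj => if_pos hj)] at this
  -- The tail is dominated by `K ∑ (1/8)^(j+1) = K / 7`, the source of the constant `7`.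
  have hgeo : HasSum (fun j : ℕ => K * (1 / 8 : ℝ) ^ (j + 1)) (K / 7) := by
    have := (hasSum_geometric_of_lt_one (r := (1 / 8 : ℝ)) (by norm_num)
      (by norm_num)).mul_left (K / 8)
    rw [show K / 8 * (1 - 1 / 8 : ℝ)⁻¹ = K / 7 by
      rw [show (1 - 1 / 8 : ℝ)⁻¹ = 8 / 7 by norm_num]; ring] at this
    exact this.congr_fun fun j => by ring
  have htot := (havg.sub hconst).sub hfin
  rw [← htot.tsum_eq, ← Real.norm_eq_abs]
  refine tsum_of_norm_bounded hgeo fun j => ?_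
  have hpos : 0 ≤ K * (1 / 8 : ℝ) ^ (j + 1) := by positivity
  by_cases hj : j ∈ T
  · simp [hj, (hT j hj).1, (hT j hj).2, hK]
  · by_cases h0 : freq (μ j) = 0
    · simp only [h0, dvd_zero, if_true, hj, if_false, sub_zero]
      rw [wave_of_freq_eq_zero h0 d x, sub_self, norm_zero]
      exact hpos
    · by_cases hd : q ∣ freq (μ j)
      · simp only [hd, h0, hj, if_true, if_false, sub_zero]
        exact (abs_mul_wave_le d j x).trans (hsmall j hj hd h0)
      · simp [hd, h0, hj, hK]

end Series

/-! ## Perturbed lacunary series -/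

/-- A positive sequence decreasing rapidly with respect to the weights `w`. -/
structure IsRapid (w B : ℕ → ℝ) : Prop where
  pos : ∀ m, 0 < B m
  le : ∀ l m, l < m → w m * B m ≤ B l * (1 / 8) ^ (m + 1)

/-- The product is built so that `w (m+1) B (m+1) = B m (1/8)^(m+2)` exactly; since `B` decreases,
the bound for consecutive indices gives it for all `l < m`. -/
theorem exists_isRapid (w : ℕ → ℝ) (hw : ∀ m, 1 ≤ w m) : ∃ B, IsRapid w B := by
  set B : ℕ → ℝ := fun m => ∏ i ∈ Finset.range (m + 1), (1 / 8) ^ (i + 1) / w i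
  have hw0 : ∀ m, 0 < w m := fun m => one_pos.trans_le (hw m)
  have hpos : ∀ m, 0 < B m := fun m => Finset.prod_pos fun i _ => by
    have := hw0 i; positivity
  have hstep : ∀ m, w (m + 1) * B (m + 1) = B m * (1 / 8) ^ (m + 1 + 1) := fun m => by
    simp only [B]
    rw [Finset.prod_range_succ _ (m + 1)]
    have := (hw0 (m + 1)).ne'
    field_simp
  have hanti : Antitone B := antitone_nat_of_succ_le fun m => by
    have h1 : B (m + 1) ≤ w (m + 1) * B (m + 1) := le_mul_of_one_le_left (hpos _).le (hw _)
    refine h1.trans ?_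
    rw [hstep]
    exact mul_le_of_le_one_right (hpos m).le (pow_le_one₀ (by norm_num) (by norm_num))
  refine ⟨B, hpos, fun l m hlm => ?_⟩
  obtain ⟨m, rfl⟩ := Nat.exists_eq_succ_of_ne_zero (Nat.ne_zero_of_lt hlm)
  rw [Nat.succ_eq_add_one, hstep]
  exact mul_le_mul_of_nonneg_right (hanti (by omega)) (by positivity)

theorem IsRapid.summable {w B : ℕ → ℝ} (h : IsRapid w B) (hw : ∀ m, 1 ≤ w m) :
    Summable fun m => w m * B m := by
  rw [← summable_nat_add_iff 1]
  have hg : Summable fun m : ℕ => B 0 * (1 / 8 : ℝ) ^ (m + 1 + 1) := by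
    have := (summable_geometric_of_lt_one (r := (1 / 8 : ℝ)) (by norm_num) (by norm_num))
    exact (((summable_nat_add_iff 2).2 this).mul_left (B 0))
  exact Summable.of_nonneg_of_le
    (fun m => mul_nonneg (zero_le_one.trans (hw _)) (h.pos _).le) (fun m => h.le 0 _ m.succ_pos) hg

section Perturbed

variable {w B : ℕ → ℝ} {M : ℕ → ℕ} {t : ℕ → ℝ}

/-- The derivative of order `d` of `∑ Bⱼ cos (Mⱼ x) + ∑ tₘ Bₘ₊₂ eₘ`. -/
def lacunary (B : ℕ → ℝ) (M : ℕ → ℕ) (t : ℕ → ℝ) (d : ℕ) (x : ℝ) : ℝ :=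
  waveSeries B (fun j => 2 * M j) d x + waveSeries (fun m => t m * B (m + 2)) id d x

/-- The weights that make a rapidly decreasing sequence suitable for `lacunary`. -/
def IsWeight (M : ℕ → ℕ) (w : ℕ → ℝ) : Prop :=
  ∀ m, 1 + (M m : ℝ) ^ 2 + ((m : ℝ) + 1) ^ 2 ≤ w m

theorem IsWeight.one_le (hw : IsWeight M w) (m : ℕ) : 1 ≤ w m :=
  le_trans (by nlinarith [sq_nonneg (M m : ℝ), sq_nonneg ((m : ℝ) + 1)]) (hw m)

theorem pow_le_one_add_sq {d : ℕ} (hd : d ≤ 2) (n : ℕ) : (n : ℝ) ^ d ≤ 1 + (n : ℝ) ^ 2 := by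
  interval_cases d
  · simp
  · nlinarith [sq_nonneg ((n : ℝ) - 1)]
  · linarith

theorem IsWeight.pow_le (hw : IsWeight M w) {d : ℕ} (hd : d ≤ 2) (m : ℕ) :
    (M m : ℝ) ^ d ≤ w m := by
  have := pow_le_one_add_sq hd (M m)
  nlinarith [hw m, sq_nonneg ((m : ℝ) + 1)]

theorem IsWeight.freq_pow_le (hw : IsWeight M w) {d : ℕ} (hd : d ≤ 2) (m : ℕ) :
    (freq m : ℝ) ^ d ≤ w (m + 2) := by
  have h1 := pow_le_one_add_sq hd (freq m)
  have h2 : (freq m : ℝ) ≤ m := by exact_mod_cast freq_le m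
  have h3 : (freq m : ℝ) ^ 2 ≤ (m : ℝ) ^ 2 := pow_le_pow_left₀ (by positivity) h2 2
  have h4 := hw (m + 2)
  push_cast at h4
  nlinarith [sq_nonneg (M (m + 2) : ℝ), (Nat.cast_nonneg m : (0 : ℝ) ≤ m)]

theorem summable_lacunary_left (hw : IsWeight M w) (hB : IsRapid w B) {d : ℕ} (hd : d ≤ 2) :
    Summable fun j => |B j| * (freq (2 * M j) : ℝ) ^ d := by
  refine Summable.of_nonneg_of_le (fun j => by positivity) (fun j => ?_) (hB.summable hw.one_le)
  rw [freq_two_mul, abs_of_pos (hB.pos j), mul_comm]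
  exact mul_le_mul_of_nonneg_right (hw.pow_le hd j) (hB.pos j).le

theorem abs_mul_pow_le (hw : IsWeight M w) (hB : IsRapid w B) (ht : ∀ m, |t m| ≤ 1) {d : ℕ}
    (hd : d ≤ 2) (m : ℕ) : |t m * B (m + 2)| * (freq m : ℝ) ^ d ≤ w (m + 2) * B (m + 2) := by
  rw [abs_mul, abs_of_pos (hB.pos _), mul_comm (w _)]
  exact mul_le_mul (mul_le_of_le_one_left (hB.pos _).le (ht m)) (hw.freq_pow_le hd m)
    (by positivity) (hB.pos _).le

theorem summable_lacunary_right (hw : IsWeight M w) (hB : IsRapid w B) (ht : ∀ m, |t m| ≤ 1)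
    {d : ℕ} (hd : d ≤ 2) : Summable fun m => |t m * B (m + 2)| * (freq (id m) : ℝ) ^ d :=
  Summable.of_nonneg_of_le (fun m => by positivity) (abs_mul_pow_le hw hB ht hd)
    ((summable_nat_add_iff 2).2 (hB.summable hw.one_le))

theorem hasDerivAt_lacunary (hw : IsWeight M w) (hB : IsRapid w B) (ht : ∀ m, |t m| ≤ 1)
    {d : ℕ} (hd : d + 1 ≤ 2) (x : ℝ) :
    HasDerivAt (lacunary B M t d) (lacunary B M t (d + 1) x) x :=
  (hasDerivAt_waveSeries (summable_lacunary_left hw hB (by omega))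
    (summable_lacunary_left hw hB hd) x).add
    (hasDerivAt_waveSeries (summable_lacunary_right hw hB ht (by omega))
      (summable_lacunary_right hw hB ht hd) x)

theorem continuous_lacunary (hw : IsWeight M w) (hB : IsRapid w B) (ht : ∀ m, |t m| ≤ 1)
    {d : ℕ} (hd : d ≤ 2) : Continuous (lacunary B M t d) :=
  (continuous_waveSeries (summable_lacunary_left hw hB hd)).add
    (continuous_waveSeries (summable_lacunary_right hw hB ht hd))

/-- The average of a perturbed lacunary series over a rotation of order `q` is dominated by its
first term with frequency a multiple of `q`. -/
theorem abs_average_lacunary_sub_le (hw : IsWeight M w) (hB : IsRapid w B) (ht : ∀ m, |t m| ≤ 1)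
    {d : ℕ} (hd : d ≤ 2) {p : ℤ} {q : ℕ} (hq : 0 < q) (hpq : IsCoprime p (q : ℤ)) {j : ℕ}
    (hjq : j ≤ q) (hdvd : q ∣ M j) (hM : M j ≠ 0) (hlt : ∀ i < j, q ∣ M i → M i = 0) (x : ℝ) :
    |(∑ i ∈ Finset.range q, lacunary B M t d (x + i * (2 * Real.pi * (p / q)))) / q -
      (waveConst B (fun j => 2 * M j) d + waveConst (fun m => t m * B (m + 2)) id d) -
        B j * wave d (2 * M j) x| ≤ 2 / 7 * B j := by
  -- The unperturbed series keeps its single leading term `j`, while the perturbation keeps none;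
  -- each contributes an error `B j / 7`.
  have h1 := abs_average_waveSeries_sub_le (summable_lacunary_left hw hB hd) hq hpq {j}
    (fun i hi => by rw [Finset.mem_singleton.1 hi, freq_two_mul]; exact ⟨hdvd, hM⟩)
    (hB.pos j).le (fun i hi hqi hi0 => ?_) x
  have h2 := abs_average_waveSeries_sub_le (summable_lacunary_right hw hB ht hd) hq hpq ∅
    (fun i hi => absurd hi (Finset.notMem_empty i))
    (hB.pos j).le (fun m _ hqm hm0 => ?_) x
  · rw [Finset.sum_singleton] at h1
    rw [Finset.sum_empty, sub_zero] at h2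
    have h3 := abs_add_le
      ((∑ i ∈ Finset.range q,
        waveSeries B (fun j => 2 * M j) d (x + i * (2 * Real.pi * (p / q)))) / q -
        waveConst B (fun j => 2 * M j) d - B j * wave d (2 * M j) x)
      ((∑ i ∈ Finset.range q,
        waveSeries (fun m => t m * B (m + 2)) id d (x + i * (2 * Real.pi * (p / q)))) / q -
        waveConst (fun m => t m * B (m + 2)) id d)
    have h4 : ∑ i ∈ Finset.range q, lacunary B M t d (x + i * (2 * Real.pi * (p / q))) =
        ∑ i ∈ Finset.range q, waveSeries B (fun j => 2 * M j) d (x + i * (2 * Real.pi * (p / q))) +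
        ∑ i ∈ Finset.range q, waveSeries (fun m => t m * B (m + 2)) id d
          (x + i * (2 * Real.pi * (p / q))) := by
      rw [← Finset.sum_add_distrib]; rfl
    rw [h4]
    refine le_trans (le_of_eq (congrArg abs ?_)) (h3.trans ((add_le_add h1 h2).trans (le_of_eq ?_)))
    · ring
    · ring
  -- A perturbing term that survives has nonzero frequency at least `q ≥ j`, and `freq m ≤ m`; hence
  -- its coefficient index `m + 2` is strictly beyond `j`.
  · have hjm : j < m + 2 := by
      have := Nat.le_of_dvd (Nat.pos_of_ne_zero hm0) hqm
      have h' := freq_le m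
      simp only [id] at this
      omega
    refine (abs_mul_pow_le hw hB ht hd m).trans ((hB.le j _ hjm).trans ?_)
    refine mul_le_mul_of_nonneg_left ?_ (hB.pos j).le
    exact pow_le_pow_of_le_one (by norm_num) (by norm_num) (by omega)
  · rw [freq_two_mul] at hqi hi0 ⊢
    have hij : j < i := by
      rcases lt_trichotomy i j with h | h | h
      · exact absurd (hlt i h hqi) hi0
      · exact absurd (Finset.mem_singleton.2 h) hi
      · exact h
    rw [abs_of_pos (hB.pos i), mul_comm]
    exact (mul_le_mul_of_nonneg_right (hw.pow_le hd i) (hB.pos i).le).trans (hB.le j i hij)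

theorem wave_zero_two_mul (n : ℕ) (x : ℝ) : wave 0 (2 * n) x = Real.cos (n * x) := by
  simp [wave, freq_two_mul, phase_two_mul]

theorem wave_one_two_mul (n : ℕ) (x : ℝ) : wave 1 (2 * n) x = -(n * Real.sin (n * x)) := by
  rw [wave, freq_two_mul, phase_two_mul, sub_zero, Nat.cast_one, one_mul,
    Real.cos_add_pi_div_two]
  ring

theorem wave_two_two_mul (n : ℕ) (x : ℝ) : wave 2 (2 * n) x = -(n ^ 2 * Real.cos (n * x)) := by
  rw [wave, freq_two_mul, phase_two_mul, sub_zero, Nat.cast_ofNat,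
    show (n * x + 2 * (Real.pi / 2) : ℝ) = n * x + Real.pi by ring, Real.cos_add_pi]
  ring

/-- Since `sin² + cos² = 1`, one of the two squares is at least `1/2`, and the corresponding
derivative of the leading term then beats the relative error `2/7`. -/
theorem two_sevenths_lt_abs {y : ℝ} (h : 1 / 2 ≤ y ^ 2) : 2 / 7 < |y| := by
  by_contra! hy
  have := pow_le_pow_left₀ (abs_nonneg y) hy 2
  rw [sq_abs] at this
  linarith

variable {f : Circle2Pi → ℝ}

theorem sum_rescale (u : ℝ → ℝ) (C : ℝ) (p : ℤ) (q : ℕ) (x : ℝ) :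
    ∑ i ∈ Finset.range q, C * u (2 * Real.pi * (x + i * ((p : ℝ) / q))) =
      C * ∑ i ∈ Finset.range q, u (2 * Real.pi * x + i * (2 * Real.pi * (p / q))) := by
  rw [Finset.mul_sum]
  refine Finset.sum_congr rfl fun i _ => ?_
  congr 2; ring

theorem hasDerivAt_rescale {u u' : ℝ → ℝ} (h : ∀ x, HasDerivAt u (u' x) x) {C C' : ℝ}
    (hC : C * (2 * Real.pi) = C') (x : ℝ) :
    HasDerivAt (fun x => C * u (2 * Real.pi * x)) (C' * u' (2 * Real.pi * x)) x := by
  have h1 : HasDerivAt (fun x : ℝ => 2 * Real.pi * x) (2 * Real.pi) x := by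
    simpa using (hasDerivAt_id x).const_mul (2 * Real.pi)
  refine (((h (2 * Real.pi * x)).comp x h1).const_mul C).congr_deriv ?_
  rw [← hC]; ring

/-- With all frequencies present, a perturbed lacunary series has infinitesimal cyclicity at
most `4`. -/
theorem infinitesimalCyclicity_lacunary_le (hw : IsWeight id w) (hB : IsRapid w B)
    (ht : ∀ m, |t m| ≤ 1) (hf : ∀ x : ℝ, f (x : Circle2Pi) = lacunary B id t 0 x) (ρ : ℝ) :
    infinitesimalCyclicity f ρ ≤ 4 := by
  have hpi := Real.two_pi_pos
  refine infinitesimalCyclicity_le_four (φ := fun x => (1 / (2 * Real.pi)) *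
      lacunary B id t 0 (2 * Real.pi * x))
    (φ₁ := fun x => 1 * lacunary B id t 1 (2 * Real.pi * x))
    (φ₂ := fun x => (2 * Real.pi) * lacunary B id t 2 (2 * Real.pi * x))
    (fun x => by rw [cover, hf]; ring)
    (hasDerivAt_rescale (hasDerivAt_lacunary hw hB ht (by norm_num)) (by field_simp))
    (hasDerivAt_rescale (hasDerivAt_lacunary hw hB ht (by norm_num)) (by ring))
    (continuous_const.mul ((continuous_lacunary hw hB ht le_rfl).comp (by fun_prop)))
    (fun p q hq hpq x => ?_) ρ
  have hqR : (1 : ℝ) ≤ q := by exact_mod_cast hq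
  have hBq := hB.pos q
  have hcos : Real.cos (4 * Real.pi * q * x) = 2 * Real.cos (q * (2 * Real.pi * x)) ^ 2 - 1 := by
    rw [← Real.cos_two_mul]; congr 1; ring
  have main : ∀ d : ℕ, d + 1 ≤ 2 → ∀ C : ℝ, C ≠ 0 →
      2 / 7 < |wave (d + 1) (2 * q) (2 * Real.pi * x)| →
      ∑ i ∈ Finset.range q, C * lacunary B id t (d + 1) (2 * Real.pi * (x + i * ((p : ℝ) / q)))
        ≠ 0 := by
    intro d hd C hC hwave h0
    rw [sum_rescale, mul_eq_zero, or_iff_right hC] at h0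
    -- All frequencies being present, the leading term has index `q` itself; constants disappear on
    -- differentiation.
    have h1 := abs_average_lacunary_sub_le hw hB ht hd hq hpq (j := q) le_rfl (dvd_refl q)
      hq.ne' (fun i hi hqi => Nat.eq_zero_of_dvd_of_lt hqi hi) (2 * Real.pi * x)
    rw [h0, waveConst_succ, waveConst_succ, zero_div, add_zero, sub_zero, zero_sub, abs_neg,
      abs_mul, abs_of_pos hBq, mul_comm] at h1
    exact absurd (le_of_mul_le_mul_right h1 hBq) (not_le.2 hwave)
  constructor
  · intro h
    refine main 1 le_rfl _ hpi.ne' ?_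
    rw [wave_two_two_mul, abs_neg, abs_mul, abs_of_nonneg (by positivity)]
    have := two_sevenths_lt_abs (y := Real.cos (q * (2 * Real.pi * x))) (by linarith)
    exact this.trans_le (le_mul_of_one_le_left (abs_nonneg _) (one_le_pow₀ hqR))
  · intro h
    refine main 0 (by norm_num) _ one_ne_zero ?_
    rw [wave_one_two_mul, abs_neg, abs_mul, abs_of_nonneg (by positivity)]
    have hsc := Real.sin_sq_add_cos_sq (q * (2 * Real.pi * x))
    have := two_sevenths_lt_abs (y := Real.sin (q * (2 * Real.pi * x))) (by linarith)
    exact this.trans_le (le_mul_of_one_le_left (abs_nonneg _) hqR)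

/-- With the frequencies `j * j!` only, a perturbed lacunary series has infinitesimal cyclicity at
least `j` at `1 / j!`. -/
theorem le_infinitesimalCyclicity_lacunary {M : ℕ → ℕ} (hMdef : ∀ j, M j = j * j.factorial)
    (hw : IsWeight M w) (hB : IsRapid w B)
    (ht : ∀ m, |t m| ≤ 1) (hf : ∀ x : ℝ, f (x : Circle2Pi) = lacunary B M t 0 x) (j : ℕ) :
    (j : ℕ∞) ≤ infinitesimalCyclicity f (1 / j.factorial) := by
  have hpi := Real.two_pi_pos
  rcases Nat.eq_zero_or_pos j with rfl | hj
  · exact zero_le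
  set q := j.factorial
  have hq : 0 < q := j.factorial_pos
  have hqR : (0 : ℝ) < q := by exact_mod_cast hq
  have hM : 0 < M j := by rw [hMdef]; exact Nat.mul_pos hj hq
  have hMR : (1 : ℝ) ≤ M j := by exact_mod_cast hM
  -- Earlier frequencies satisfy `i · i! < (i + 1)! ≤ j! = q`, so none of them is a nonzero multiple
  -- of `q`.
  have hlt : ∀ i < j, q ∣ M i → M i = 0 := fun i hi hqi => by
    refine Nat.eq_zero_of_dvd_of_lt hqi ?_
    rw [hMdef]
    calc i * i.factorial < (i + 1) * i.factorial :=
          Nat.mul_lt_mul_of_pos_right (Nat.lt_succ_self i) i.factorial_pos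
      _ = (i + 1).factorial := (Nat.factorial_succ i).symm
      _ ≤ q := Nat.factorial_le hi
  have main : ∀ d ≤ 2, ∀ x, |(∑ i ∈ Finset.range q,
      lacunary B M t d (x + i * (2 * Real.pi * ((1 : ℤ) / q)))) / q -
      (waveConst B (fun j => 2 * M j) d + waveConst (fun m => t m * B (m + 2)) id d) -
        B j * wave d (2 * M j) x| ≤ 2 / 7 * B j := fun d hd x =>
    abs_average_lacunary_sub_le hw hB ht hd hq isCoprime_one_left (Nat.self_le_factorial j)
      (by rw [hMdef]; exact dvd_mul_left _ _) hM.ne' hlt x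
  set C₀ := waveConst B (fun j => 2 * M j) 0 + waveConst (fun m => t m * B (m + 2)) id 0
  have hBj := hB.pos j
  have hsqrt : 2 / 7 < Real.sqrt 2 / 2 := by
    have : (1 : ℝ) ≤ Real.sqrt 2 := Real.one_le_sqrt.2 (by norm_num)
    linarith
  have hNq : ((j * q : ℕ) : ℝ) = M j := by rw [hMdef]
  -- The leading term is `cos (2π j q x)` in the unit coordinate; the offsets `1/8` and `3/8` have
  -- phases `π/4` and `3π/4`, where it equals `±√2/2` and beats the error `2/7`.
  have hphase : ∀ (k : ℕ) (s : ℝ), (M j : ℝ) * (2 * Real.pi * ((k + s) / (j * q : ℕ))) =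
      2 * Real.pi * s + k * (2 * Real.pi) := fun k s => by
    rw [hNq]; field_simp; ring
  have hresc : ∀ (C : ℝ) (d : ℕ) (x : ℝ),
      ∑ i ∈ Finset.range q, C * lacunary B M t d (2 * Real.pi * (x + i * (1 / q : ℝ))) =
      C * ∑ i ∈ Finset.range q,
        lacunary B M t d (2 * Real.pi * x + i * (2 * Real.pi * ((1 : ℤ) / q))) := fun C d x => by
    have := sum_rescale (lacunary B M t d) C 1 q x
    rwa [Int.cast_one] at this ⊢
  refine le_infinitesimalCyclicity (φ := fun x => (1 / (2 * Real.pi)) *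
      lacunary B M t 0 (2 * Real.pi * x))
    (φ₁ := fun x => 1 * lacunary B M t 1 (2 * Real.pi * x))
    (fun x => by rw [cover, hf]; ring)
    (hasDerivAt_rescale (hasDerivAt_lacunary hw hB ht (by norm_num)) (by field_simp))
    (continuous_const.mul ((continuous_lacunary hw hB ht (by norm_num)).comp (by fun_prop)))
    hq ((1 / (2 * Real.pi)) * (C₀ * q)) (fun k _ => ?_) (fun k _ => ?_) (fun k _ x hx => ?_)
  · rw [hresc]
    refine mul_lt_mul_of_pos_left ?_ (by positivity)
    rw [← lt_div_iff₀ hqR]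
    have h1 := (abs_le.1 (main 0 (by norm_num) (2 * Real.pi * ((k + 1 / 8) / (j * q : ℕ))))).1
    rw [wave_zero_two_mul, hphase, Real.cos_add_nat_mul_two_pi,
      show 2 * Real.pi * (1 / 8) = Real.pi / 4 by ring, Real.cos_pi_div_four] at h1
    have := mul_lt_mul_of_pos_left hsqrt hBj
    linarith
  · rw [hresc]
    refine mul_lt_mul_of_pos_left ?_ (by positivity)
    rw [← div_lt_iff₀ hqR]
    have h1 := (abs_le.1 (main 0 (by norm_num) (2 * Real.pi * ((k + 3 / 8) / (j * q : ℕ))))).2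
    rw [wave_zero_two_mul, hphase, Real.cos_add_nat_mul_two_pi,
      show 2 * Real.pi * (3 / 8) = Real.pi - Real.pi / 4 by ring, Real.cos_pi_sub,
      Real.cos_pi_div_four] at h1
    have := mul_lt_mul_of_pos_left hsqrt hBj
    linarith
  · rw [hresc, one_mul]
    have h1 := (abs_le.1 (main 1 (by norm_num) (2 * Real.pi * x))).2
    rw [waveConst_succ, waveConst_succ, add_zero, sub_zero, wave_one_two_mul] at h1
    -- Between the two offsets the phase stays within `π/4` of `π/2`, so the derivative of the
    -- leading term is negative with the same margin.
    have hsin : Real.sqrt 2 / 2 ≤ Real.sin (M j * (2 * Real.pi * x)) := by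
      rw [hNq, Set.mem_Icc, div_le_iff₀ (by linarith), le_div_iff₀ (by linarith)] at hx
      have hy : M j * (2 * Real.pi * x) =
          Real.pi / 2 - (Real.pi / 2 - 2 * Real.pi * (M j * x - k)) + k * (2 * Real.pi) := by ring
      rw [hy, Real.sin_add_nat_mul_two_pi, Real.sin_pi_div_two_sub, ← Real.cos_pi_div_four,
        ← Real.cos_abs (Real.pi / 2 - _)]
      refine Real.cos_le_cos_of_nonneg_of_le_pi (abs_nonneg _) (by linarith) ?_
      rw [abs_le]
      constructor <;> nlinarith
    have h2 : 2 / 7 * B j < B j * (M j * Real.sin (M j * (2 * Real.pi * x))) := by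
      rw [mul_comm]
      refine mul_lt_mul_of_pos_left ?_ hBj
      nlinarith
    have h3 : (∑ i ∈ Finset.range q,
        lacunary B M t 1 (2 * Real.pi * x + i * (2 * Real.pi * ((1 : ℤ) / q)))) / q < 0 := by
      linarith
    by_contra! hcon
    exact absurd (div_nonneg hcon hqR.le) (not_le.2 h3)

end Perturbed

/-! ## Trigonometric polynomials -/

/-- The space of trigonometric polynomials. -/
def trigPolynomials : Submodule ℝ (ℝ → ℝ) := Submodule.span ℝ (Set.range (wave 0))

theorem wave_zero (m : ℕ) (x : ℝ) : wave 0 m x = Real.cos (freq m * x - phase m) := by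
  simp [wave]

theorem wave_zero_two_mul_add_one (n : ℕ) (x : ℝ) :
    wave 0 (2 * n + 1) x = Real.sin ((n + 1 : ℕ) * x) := by
  have h1 : freq (2 * n + 1) = n + 1 := by unfold freq; omega
  have h2 : phase (2 * n + 1) = Real.pi / 2 := by
    rw [phase, if_neg (by simp)]
  rw [wave_zero, h1, h2, Real.cos_sub_pi_div_two]

theorem cos_nat_mul_mem (n : ℕ) : (fun x : ℝ => Real.cos (n * x)) ∈ trigPolynomials :=
  Submodule.subset_span ⟨2 * n, funext fun x => wave_zero_two_mul n x⟩

theorem sin_nat_mul_mem (n : ℕ) : (fun x : ℝ => Real.sin (n * x)) ∈ trigPolynomials := by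
  rcases n with _ | n
  · convert Submodule.zero_mem _ using 1
    ext x; simp
  · exact Submodule.subset_span ⟨2 * n + 1, funext fun x => wave_zero_two_mul_add_one n x⟩

theorem cos_int_mul_add_mem (n : ℤ) (θ : ℝ) :
    (fun x : ℝ => Real.cos (n * x + θ)) ∈ trigPolynomials := by
  obtain ⟨k, rfl | rfl⟩ := n.eq_nat_or_neg
  · convert Submodule.sub_mem _ (Submodule.smul_mem _ (Real.cos θ) (cos_nat_mul_mem k))
      (Submodule.smul_mem _ (Real.sin θ) (sin_nat_mul_mem k)) using 1
    ext x
    simp only [Int.cast_natCast, Real.cos_add, Pi.sub_apply, Pi.smul_apply, smul_eq_mul]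
    ring
  · convert Submodule.add_mem _ (Submodule.smul_mem _ (Real.cos θ) (cos_nat_mul_mem k))
      (Submodule.smul_mem _ (Real.sin θ) (sin_nat_mul_mem k)) using 1
    ext x
    simp only [Int.cast_neg, Int.cast_natCast, Real.cos_add, neg_mul, Real.cos_neg, Real.sin_neg,
      Pi.add_apply, Pi.smul_apply, smul_eq_mul]
    ring

/-- Product-to-sum formula; the phase `α` covers multiplication by both cosine and sine. -/
theorem cos_add_mul_mem (α : ℝ) {u : ℝ → ℝ} (hu : u ∈ trigPolynomials) :
    (fun x => Real.cos (x + α) * u x) ∈ trigPolynomials := by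
  induction hu using Submodule.span_induction with
  | mem u hu =>
    obtain ⟨m, rfl⟩ := hu
    convert Submodule.smul_mem _ (1 / 2 : ℝ)
      (Submodule.add_mem _ (cos_int_mul_add_mem (freq m + 1) (-phase m + α))
        (cos_int_mul_add_mem (freq m - 1) (-phase m - α))) using 1
    ext x
    simp only [wave_zero, Pi.add_apply, Pi.smul_apply, smul_eq_mul]
    have h1 : ((freq m + 1 : ℤ) : ℝ) * x + (-phase m + α) =
        (freq m * x - phase m) + (x + α) := by push_cast; ring
    have h2 : ((freq m - 1 : ℤ) : ℝ) * x + (-phase m - α) =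
        (freq m * x - phase m) - (x + α) := by push_cast; ring
    rw [h1, h2, Real.cos_add (_ - _), Real.cos_sub (_ - _) (_ + _)]
    ring
  | zero => convert Submodule.zero_mem _ using 1; ext x; simp
  | add u v _ _ hu hv =>
    convert Submodule.add_mem _ hu hv using 1
    ext x; simp [mul_add]
  | smul a u _ hu =>
    convert Submodule.smul_mem _ a hu using 1
    ext x; simp; ring

/-- The addition formula `cos (y - x) = cos y cos x + sin y sin x` peels off one factor of the
kernel: the `y`-part is absorbed into `u`, the `x`-part multiplies a trigonometric polynomial. -/
theorem integral_kernel_mem (n : ℕ) : ∀ {u : ℝ → ℝ}, Continuous u →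
    (fun x => ∫ y in (-Real.pi)..Real.pi, (1 + Real.cos (y - x)) ^ n * u y) ∈ trigPolynomials := by
  induction n with
  | zero =>
    intro u _
    convert Submodule.smul_mem _ (∫ y in (-Real.pi)..Real.pi, u y) (cos_nat_mul_mem 0) using 1
    ext x; simp
  | succ n ih =>
    intro u hu
    have hsin : (fun x : ℝ => Real.cos (x + -(Real.pi / 2))) = Real.sin := by
      ext x; rw [← sub_eq_add_neg, Real.cos_sub_pi_div_two]
    have h1 := ih hu
    have h2 := cos_add_mul_mem 0 (ih (u := fun y => Real.cos y * u y) (by fun_prop))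
    have h3 := cos_add_mul_mem (-(Real.pi / 2)) (ih (u := fun y => Real.sin y * u y) (by fun_prop))
    convert Submodule.add_mem _ h1 (Submodule.add_mem _ h2 h3) using 1
    ext x
    have hx : Real.cos (x + -(Real.pi / 2)) = Real.sin x := congrFun hsin x
    simp only [Pi.add_apply, add_zero, hx]
    rw [← intervalIntegral.integral_const_mul, ← intervalIntegral.integral_const_mul,
      ← intervalIntegral.integral_add, ← intervalIntegral.integral_add]
    · refine intervalIntegral.integral_congr fun y _ => ?_
      simp only [Real.cos_sub]
      ring
    all_goals exact Continuous.intervalIntegrable (by fun_prop) _ _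

/-! ### Orthogonality of the trigonometric system. -/

theorem integral_cos_int_mul_add (n : ℤ) (θ : ℝ) :
    ∫ x in (0 : ℝ)..(2 * Real.pi), Real.cos (n * x + θ) =
      if n = 0 then 2 * Real.pi * Real.cos θ else 0 := by
  split_ifs with h
  · subst h; simp
  · have hn : (n : ℝ) ≠ 0 := by exact_mod_cast h
    rw [intervalIntegral.integral_comp_mul_add (fun y => Real.cos y) hn, integral_cos,
      show (n : ℝ) * (2 * Real.pi) + θ = θ + n * (2 * Real.pi) by ring, Real.sin_add_int_mul_two_pi]
    simp

theorem integral_wave_mul_wave (l m : ℕ) :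
    ∫ x in (0 : ℝ)..(2 * Real.pi), wave 0 l x * wave 0 m x =
      ((if (freq l + freq m : ℤ) = 0 then 2 * Real.pi * Real.cos (-phase l - phase m) else 0) +
      (if (freq l - freq m : ℤ) = 0 then 2 * Real.pi * Real.cos (-phase l + phase m) else 0)) / 2 := by
  rw [← integral_cos_int_mul_add, ← integral_cos_int_mul_add, ← intervalIntegral.integral_add,
    ← intervalIntegral.integral_div]
  · refine intervalIntegral.integral_congr fun x _ => ?_
    simp only [wave_zero]
    have h1 : ((freq l + freq m : ℤ) : ℝ) * x + (-phase l - phase m) =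
        (freq l * x - phase l) + (freq m * x - phase m) := by push_cast; ring
    have h2 : ((freq l - freq m : ℤ) : ℝ) * x + (-phase l + phase m) =
        (freq l * x - phase l) - (freq m * x - phase m) := by push_cast; ring
    rw [h1, h2, Real.cos_add (_ - _), Real.cos_sub (_ - _) (_ - _)]
    ring
  all_goals exact Continuous.intervalIntegrable (by fun_prop) _ _

theorem integral_wave_mul_wave_of_ne {l m : ℕ} (h : l ≠ m) :
    ∫ x in (0 : ℝ)..(2 * Real.pi), wave 0 l x * wave 0 m x = 0 := by
  rw [integral_wave_mul_wave, if_neg (by unfold freq; omega)]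
  split_ifs with h0
  · have : Real.cos (-phase l + phase m) = 0 := by
      unfold freq at h0
      rcases Nat.even_or_odd l with hl | hl <;> rcases Nat.even_or_odd m with hm | hm
      · exfalso; obtain ⟨a, rfl⟩ := hl; obtain ⟨b, rfl⟩ := hm; omega
      · simp [phase, hl, Nat.not_even_iff_odd.2 hm]
      · simp [phase, hm, Nat.not_even_iff_odd.2 hl]
      · exfalso; obtain ⟨a, rfl⟩ := hl; obtain ⟨b, rfl⟩ := hm; omega
    rw [this]; simp
  · simp

theorem integral_wave_mul_self_ne_zero (m : ℕ) :
    ∫ x in (0 : ℝ)..(2 * Real.pi), wave 0 m x * wave 0 m x ≠ 0 := by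
  rw [integral_wave_mul_wave, if_pos (sub_self _)]
  have := Real.pi_pos
  split_ifs with h
  · have : m = 0 := by unfold freq at h; omega
    subst this
    simp [phase]
  · simp

/-! ## Function spaces with continuous translations -/

/-- A normed space of continuous `2π`-periodic functions which contains the trigonometric functions
and on which the translations act continuously. -/
structure TranslationSpace (X : Type*) [NormedAddCommGroup X] [NormedSpace ℝ X] where
  /-- the value at a point -/
  ev : ℝ → X →L[ℝ] ℝ
  ev_injective : ∀ F, (∀ x, ev x F = 0) → F = 0
  continuous_ev : ∀ F, Continuous fun x => ev x F
  periodic_ev : ∀ F, Periodic (fun x => ev x F) (2 * Real.pi)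
  /-- translation -/
  trans : X → ℝ → X
  continuous_trans : ∀ F, Continuous (trans F)
  ev_trans : ∀ F s x, ev x (trans F s) = ev (x + s) F
  /-- the trigonometric functions -/
  trig : ℕ → X
  ev_trig : ∀ m x, ev x (trig m) = wave 0 m x

namespace TranslationSpace

variable {X : Type*} [NormedAddCommGroup X] [NormedSpace ℝ X] (S : TranslationSpace X)

/-- A vanishing combination in `X` vanishes pointwise; integrating it against one trigonometric
function isolates the coefficient by orthogonality. -/
theorem linearIndependent_trig : LinearIndependent ℝ S.trig := by
  rw [linearIndependent_iff']
  intro s g hg m hm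
  have h1 : ∀ x, ∑ i ∈ s, g i * wave 0 i x = 0 := fun x => by
    have := congrArg (S.ev x) hg
    simpa [S.ev_trig] using this
  have h2 : ∑ i ∈ s, g i * ∫ x in (0 : ℝ)..(2 * Real.pi), wave 0 i x * wave 0 m x = 0 := by
    simp_rw [← intervalIntegral.integral_const_mul]
    rw [← intervalIntegral.integral_finsetSum]
    · rw [intervalIntegral.integral_congr (g := fun _ => (0 : ℝ))]
      · simp
      · intro x _
        simp only [← mul_assoc, ← Finset.sum_mul, h1, zero_mul]
    · intro i _
      exact ((continuous_const.mul ((continuous_wave 0 i).mul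
        (continuous_wave 0 m))).intervalIntegrable _ _)
  rw [Finset.sum_eq_single_of_mem m hm
    (fun i _ him => by rw [integral_wave_mul_wave_of_ne him, mul_zero])] at h2
  exact (mul_eq_zero.1 h2).resolve_right (integral_wave_mul_self_ne_zero m)

theorem ext_ev {F G : X} (h : ∀ x, S.ev x F = S.ev x G) : F = G :=
  sub_eq_zero.1 (S.ev_injective _ fun x => by rw [map_sub, h, sub_self])

theorem mem_span_trig {F : X} (hF : (fun x => S.ev x F) ∈ trigPolynomials) :
    F ∈ Submodule.span ℝ (Set.range S.trig) := by
  set E : X →ₗ[ℝ] (ℝ → ℝ) := LinearMap.pi fun x => (S.ev x : X →ₗ[ℝ] ℝ)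
  have h1 : (Submodule.span ℝ (Set.range S.trig)).map E = trigPolynomials := by
    rw [Submodule.map_span, ← Set.range_comp, trigPolynomials]
    congr 2
    ext m x
    exact S.ev_trig m x
  rw [← h1] at hF
  obtain ⟨G, hG, hGF⟩ := hF
  have : G = F := S.ext_ev fun x => congrFun hGF x
  rwa [← this]

/-- Averages of the translates of `F` with weight `(1 + cos s)^n`, normalised, are vector-valued
integrals in `X`. The weight concentrates at `s = 0`, so they converge to `F` in norm, and pointwise
evaluation shows that each is a trigonometric polynomial. -/
theorem dense_span_trig [CompleteSpace X] :
    Dense (Submodule.span ℝ (Set.range S.trig) : Set X) := by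
  intro F
  have hpi := Real.pi_pos
  have hlim := tendsto_setIntegral_pow_smul_of_unique_maximum_of_isCompact_of_continuousOn
    (μ := volume) (s := Set.Icc (-Real.pi) Real.pi) (x₀ := 0) isCompact_Icc
    (c := fun s => 1 + Real.cos s) (g := S.trans F) (by fun_prop)
    (fun y hy hy0 => by
      rw [Real.cos_zero]
      have h1 : Real.cos y ≠ 1 := fun h => hy0
        ((Real.cos_eq_one_iff_of_lt_of_lt (by linarith [hy.1]) (by linarith [hy.2])).1 h)
      linarith [lt_of_le_of_ne (Real.cos_le_one y) h1])
    (fun y _ => by linarith [Real.neg_one_le_cos y]) (by rw [Real.cos_zero]; norm_num)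
    (by
      rw [interior_Icc, closure_Ioo (by linarith)]
      exact ⟨by linarith, by linarith⟩)
    (S.continuous_trans F).continuousOn
  have h0 : S.trans F 0 = F := S.ext_ev fun x => by rw [S.ev_trans, add_zero]
  rw [h0] at hlim
  refine mem_closure_of_tendsto hlim (Eventually.of_forall fun n => ?_)
  refine Submodule.smul_mem _ _ (S.mem_span_trig ?_)
  convert integral_kernel_mem n (S.continuous_ev F) using 1
  ext x
  rw [integral_Icc_eq_integral_Ioc, ← intervalIntegral.integral_of_le (by linarith),
    ← ContinuousLinearMap.intervalIntegral_comp_comm]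
  -- Periodicity moves the window of integration, turning the average of translates of `F` into the
  -- convolution handled by `integral_kernel_mem`.
  · have hp : Periodic (fun y => (1 + Real.cos (y - x)) ^ n * S.ev y F) (2 * Real.pi) := fun y => by
      have := S.periodic_ev F y
      simp only at this ⊢
      rw [this, show y + 2 * Real.pi - x = y - x + 2 * Real.pi by ring, Real.cos_add_two_pi]
    have h1 := hp.intervalIntegral_add_eq (-Real.pi) (-Real.pi + x)
    rw [show -Real.pi + 2 * Real.pi = Real.pi by ring,
      show -Real.pi + x + 2 * Real.pi = Real.pi + x by ring] at h1
    rw [h1, ← intervalIntegral.integral_comp_add_right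
      (fun y => (1 + Real.cos (y - x)) ^ n * S.ev y F)]
    refine intervalIntegral.integral_congr fun s _ => ?_
    simp only [map_smul, S.ev_trans, smul_eq_mul, add_sub_cancel_right]
    rw [add_comm s x]
  · exact Continuous.intervalIntegrable
      ((by fun_prop : Continuous fun s : ℝ => (1 + Real.cos s) ^ n).smul (S.continuous_trans F)) _ _

/-- A set which avoids all the perturbed lacunary series with given frequencies is null for some
cube measure, and its complement is not. -/
theorem exists_isCubeMeasure [CompleteSpace X] [MeasurableSpace X] [BorelSpace X] (M : ℕ → ℕ)
    {E : Set X} (hE : ∀ (F : X) (w B t : ℕ → ℝ), IsWeight M w → IsRapid w B → (∀ m, |t m| ≤ 1) →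
      (∀ x, S.ev x F = lacunary B M t 0 x) → F ∉ E) :
    ∃ μ : Measure X, IsCubeMeasure μ ∧ μ E = 0 ∧ μ Eᶜ ≠ 0 := by
  -- The norms in `X` enter the weights so that both series converge in `X`; the truncated index `m
  -- - 2` matches the coefficient shift `B (m + 2)`.
  set w : ℕ → ℝ := fun m => 1 + (M m : ℝ) ^ 2 + ((m : ℝ) + 1) ^ 2 +
    (‖S.trig (2 * M m)‖ + ‖S.trig (m - 2)‖)
  have hw : IsWeight M w := fun m => le_add_of_nonneg_right (by positivity)
  obtain ⟨B, hB⟩ := exists_isRapid w hw.one_le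
  have hsum := hB.summable hw.one_le
  have hw1 : ∀ m, ‖S.trig (2 * M m)‖ ≤ w m := fun m => by
    have : 0 ≤ 1 + (M m : ℝ) ^ 2 + ((m : ℝ) + 1) ^ 2 + ‖S.trig (m - 2)‖ := by positivity
    simp only [w]; linarith
  have hw2 : ∀ m, ‖S.trig m‖ ≤ w (m + 2) := fun m => by
    have : 0 ≤ 1 + (M (m + 2) : ℝ) ^ 2 + (((m + 2 : ℕ) : ℝ) + 1) ^ 2 +
      ‖S.trig (2 * M (m + 2))‖ := by positivity
    simp only [w, Nat.add_sub_cancel]; linarith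
  have hs1 : Summable fun j => B j • S.trig (2 * M j) := by
    refine Summable.of_norm_bounded hsum fun j => ?_
    rw [norm_smul, Real.norm_of_nonneg (hB.pos j).le, mul_comm]
    exact mul_le_mul_of_nonneg_right (hw1 j) (hB.pos j).le
  set x₀ : X := ∑' j, B j • S.trig (2 * M j)
  set v : ℕ → X := fun m => B (m + 2) • S.trig m
  have hs2 : Summable fun m => ‖v m‖ := by
    refine Summable.of_nonneg_of_le (fun m => norm_nonneg _) (fun m => ?_)
      ((summable_nat_add_iff 2).2 hsum)
    rw [norm_smul, Real.norm_of_nonneg (hB.pos _).le, mul_comm]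
    exact mul_le_mul_of_nonneg_right (hw2 m) (hB.pos _).le
  have htv : ∀ (t : ℕ → unitInterval) (m : ℕ), ‖(t m : ℝ) • v m‖ ≤ ‖v m‖ := fun t m => by
    rw [norm_smul, Real.norm_of_nonneg (t m).2.1]
    exact mul_le_of_le_one_left (norm_nonneg _) (t m).2.2
  set Φ : (ℕ → unitInterval) → X := fun t => x₀ + ∑' m, (t m : ℝ) • v m
  have hΦ : Continuous Φ := continuous_const.add <| continuous_tsum
    (fun m => (continuous_subtype_val.comp (continuous_apply m)).smul continuous_const) hs2
    fun m t => htv t m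
  have hnot : ∀ t, Φ t ∉ E := fun t => by
    refine hE (Φ t) w B (fun m => t m) hw hB
      (fun m => by rw [abs_of_nonneg (t m).2.1]; exact (t m).2.2) fun x => ?_
    have ht : Summable fun m => (t m : ℝ) • v m := Summable.of_norm_bounded hs2 (htv t)
    rw [map_add, ContinuousLinearMap.map_tsum _ hs1, ContinuousLinearMap.map_tsum _ ht]
    simp only [v, map_smul, S.ev_trig, smul_eq_mul, lacunary, waveSeries, id, mul_assoc]
  -- Measurability of `E` is not known; it is null because it lies in the complement of the compact
  -- image of the cube.
  have hcompl : IsClosed (Set.range Φ) := (isCompact_range hΦ).isClosed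
  have hE0 : (hilbertCubeMeasure.map Φ) E = 0 := by
    refine measure_mono_null (t := (Set.range Φ)ᶜ) ?_ ?_
    · rintro _ hF ⟨t, rfl⟩
      exact hnot t hF
    · rw [Measure.map_apply hΦ.measurable hcompl.measurableSet.compl]
      convert measure_empty (μ := hilbertCubeMeasure)
      ext t; simp
  have hspan : Submodule.span ℝ (Set.range v) = Submodule.span ℝ (Set.range S.trig) := by
    apply le_antisymm
    · rw [Submodule.span_le]
      rintro _ ⟨m, rfl⟩
      exact Submodule.smul_mem _ _ (Submodule.subset_span ⟨m, rfl⟩)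
    · rw [Submodule.span_le]
      rintro _ ⟨m, rfl⟩
      have : S.trig m = (B (m + 2))⁻¹ • v m := by
        simp only [v]; rw [inv_smul_smul₀ (hB.pos _).ne']
      rw [this]
      exact Submodule.smul_mem _ _ (Submodule.subset_span ⟨m, rfl⟩)
  refine ⟨hilbertCubeMeasure.map Φ, ⟨x₀, v, ?_, ?_, hs2, rfl⟩, hE0, fun hE1 => ?_⟩
  · exact S.linearIndependent_trig.units_smul fun m => Units.mk0 (B (m + 2)) (hB.pos _).ne'
  · rw [hspan]; exact S.dense_span_trig
  · have : IsProbabilityMeasure hilbertCubeMeasure := by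
      unfold hilbertCubeMeasure; infer_instance
    have h1 : (hilbertCubeMeasure.map Φ) Set.univ = 1 := by
      rw [Measure.map_apply hΦ.measurable MeasurableSet.univ, Set.preimage_univ, measure_univ]
    -- A probability measure cannot vanish on both `E` and its complement; subadditivity needs no
    -- measurability.
    have h2 := measure_union_le (μ := hilbertCubeMeasure.map Φ) E Eᶜ
    rw [Set.union_compl_self, h1, hE0, hE1, add_zero] at h2
    simp at h2

end TranslationSpace

/-! ## The space `C^k(S)` -/

namespace Ck

variable {k : ℕ}

/-- The element of `C^k(S)` given by a periodic function on the line. -/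
def mk (u : ℝ → ℝ) (hp : Periodic u (2 * Real.pi)) (hu : ContDiff ℝ k u) : Ck k :=
  ⟨hp.lift, hu⟩

theorem lift_mk (u : ℝ → ℝ) (hp : Periodic u (2 * Real.pi)) (hu : ContDiff ℝ k u) :
    (mk u hp hu).lift = u := rfl

theorem jet_apply (f : Ck k) (j : Fin (k + 1)) (x : ℝ) : jet f j x = iteratedDeriv j f.lift x := rfl

theorem norm_jet (f : Ck k) : ‖jet f‖ = ‖f‖ := rfl

theorem ext_lift {f g : Ck k} (h : ∀ x, f.lift x = g.lift x) : f = g := by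
  have : f.lift = g.lift := funext h
  refine jet_injective (funext fun j => ?_)
  ext x
  rw [jet_apply, jet_apply, this]

theorem norm_le {f : Ck k} {C : ℝ} (hC : 0 ≤ C)
    (h : ∀ (j : ℕ), j ≤ k → ∀ x, |iteratedDeriv j f.lift x| ≤ C) : ‖f‖ ≤ C := by
  rw [← norm_jet, pi_norm_le_iff_of_nonneg hC]
  intro j
  rw [BoundedContinuousFunction.norm_le hC]
  exact fun x => h j (Nat.lt_succ_iff.1 j.2) x

theorem abs_lift_le (f : Ck k) (x : ℝ) : |f.lift x| ≤ ‖f‖ := by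
  have h1 := (jet f 0).norm_coe_le_norm x
  rw [jet_apply, Fin.val_zero, iteratedDeriv_zero] at h1
  exact h1.trans ((norm_le_pi_norm (jet f) 0).trans_eq (norm_jet f))

instance : CompleteSpace (Ck k) := by
  refine Metric.complete_of_cauchySeq_tendsto fun u hu => ?_
  have hiso : Isometry (jet : Ck k → (Fin (k + 1) → (ℝ →ᵇ ℝ))) :=
    AddMonoidHomClass.isometry_of_norm jet norm_jet
  obtain ⟨g, hg⟩ := cauchySeq_tendsto_of_complete (hiso.uniformContinuous.comp_cauchySeq hu)
  have hgj : ∀ j : Fin (k + 1), TendstoUniformly (fun n => iteratedDeriv j (u n).lift) (g j) atTop := fun j =>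
    BoundedContinuousFunction.tendsto_iff_tendstoUniformly.1 ((tendsto_pi_nhds.1 hg) j)
  -- Under the isometric embedding by jets a Cauchy sequence has a limit; uniform convergence of
  -- consecutive derivatives makes that limit the jet of a function.
  have hder : ∀ (j : ℕ) (hj : j < k) (x : ℝ),
      HasDerivAt (g ⟨j, by omega⟩) (g ⟨j + 1, by omega⟩ x) x := fun j hj x => by
    refine hasDerivAt_of_tendstoUniformly (hgj ⟨j + 1, by omega⟩)
      (Eventually.of_forall fun n y => ?_) (fun y => (hgj ⟨j, by omega⟩).tendsto_at y) x
    have hd := (u n).contDiff_lift.differentiable_iteratedDeriv j (by exact_mod_cast hj)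
    have := (hd y).hasDerivAt
    rwa [← iteratedDeriv_succ] at this
  have hit : ∀ (j : ℕ) (hj : j ≤ k), iteratedDeriv j (g 0) = g ⟨j, by omega⟩ := fun j => by
    induction j with
    | zero => intro _; rw [iteratedDeriv_zero]; rfl
    | succ j ih =>
      intro hj
      rw [iteratedDeriv_succ, ih (by omega)]
      exact funext fun x => (hder j hj x).deriv
  have hcd : ContDiff ℝ k (g 0) := by
    rw [contDiff_nat_iff_iteratedDeriv]
    refine ⟨fun m hm => ?_, fun m hm => ?_⟩
    · rw [hit m hm]; exact (g _).continuous
    · rw [hit m hm.le]; exact fun x => (hder m hm x).differentiableAt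
  have hper : Periodic (g 0) (2 * Real.pi) := fun x => by
    refine tendsto_nhds_unique ((hgj 0).tendsto_at (x + 2 * Real.pi)) ?_
    refine ((hgj 0).tendsto_at x).congr fun n => ?_
    exact ((u n).periodic_iteratedDeriv_lift _ x).symm
  refine ⟨mk (g 0) hper hcd, ?_⟩
  rw [hiso.isEmbedding.tendsto_nhds_iff]
  have : jet (mk (g 0) hper hcd) = g := by
    ext j x
    rw [jet_apply, lift_mk, hit j (Nat.lt_succ_iff.1 j.2)]
  rw [this]
  exact hg

/-- Evaluation at a point of the line. -/
def evalCLM (x : ℝ) : Ck k →L[ℝ] ℝ :=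
  LinearMap.mkContinuous ⟨⟨fun f => f.lift x, fun _ _ => rfl⟩, fun _ _ => rfl⟩ 1 fun f => by
    rw [one_mul]; exact f.abs_lift_le x

/-- The translate of a function. -/
def translate (f : Ck k) (s : ℝ) : Ck k :=
  mk (fun x => f.lift (x + s)) (fun x => by
    change f.lift (x + 2 * Real.pi + s) = f.lift (x + s)
    rw [show x + 2 * Real.pi + s = x + s + 2 * Real.pi by ring, f.periodic_lift])
    (f.contDiff_lift.comp (contDiff_id.add contDiff_const))

/-- By periodicity the supremum norms are controlled on one period, a compact set, where joint
continuity of each derivative gives uniform smallness. -/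
theorem continuous_translate (f : Ck k) : Continuous (translate f) := by
  rw [continuous_iff_continuousAt]
  intro s₀
  rw [ContinuousAt, Metric.tendsto_nhds]
  intro ε hε
  have hev : ∀ᶠ s in 𝓝 s₀, ∀ j ∈ Finset.range (k + 1), ∀ x ∈ Set.Icc 0 (2 * Real.pi),
      |iteratedDeriv j f.lift (x + s) - iteratedDeriv j f.lift (x + s₀)| < ε / 2 := by
    rw [Filter.eventually_all_finset]
    intro j hj
    have hc := f.continuous_iteratedDeriv_lift ⟨j, Finset.mem_range.1 hj⟩
    refine isCompact_Icc.eventually_forall_of_forall_eventually fun x _ => ?_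
    have hcont : Continuous fun y : ℝ × ℝ =>
        |iteratedDeriv j f.lift (y.2 + y.1) - iteratedDeriv j f.lift (y.2 + s₀)| :=
      ((hc.comp (by fun_prop : Continuous fun y : ℝ × ℝ => y.2 + y.1)).sub
        (hc.comp (by fun_prop : Continuous fun y : ℝ × ℝ => y.2 + s₀))).abs
    exact hcont.continuousAt.eventually_lt continuousAt_const (by simpa using half_pos hε)
  filter_upwards [hev] with s hs
  rw [dist_eq_norm]
  refine lt_of_le_of_lt (norm_le (half_pos hε).le fun j hj x => ?_) (half_lt_self hε)
  have h1 : iteratedDeriv j (translate f s - translate f s₀).lift x =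
      iteratedDeriv j f.lift (x + s) - iteratedDeriv j f.lift (x + s₀) := by
    rw [← jet_apply (translate f s - translate f s₀) ⟨j, by omega⟩, map_sub]
    exact congrArg₂ (fun a b : ℝ => a - b) (congrFun (iteratedDeriv_comp_add_const j f.lift s) x)
      (congrFun (iteratedDeriv_comp_add_const j f.lift s₀) x)
  rw [h1]
  obtain ⟨y, hy, n, hn⟩ : ∃ y ∈ Set.Icc 0 (2 * Real.pi), ∃ n : ℤ, x = y + n * (2 * Real.pi) :=
    ⟨toIcoMod Real.two_pi_pos 0 x,
      Set.Ico_subset_Icc_self (by simpa using toIcoMod_mem_Ico Real.two_pi_pos 0 x),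
      toIcoDiv Real.two_pi_pos 0 x, by
        rw [← zsmul_eq_mul, toIcoMod_add_toIcoDiv_zsmul]⟩
  have hp := (f.periodic_iteratedDeriv_lift j).int_mul n
  rw [hn, add_right_comm, hp, add_right_comm, hp]
  exact (hs j (Finset.mem_range.2 (by omega)) y hy).le

theorem contDiff_wave (m : ℕ) : ContDiff ℝ k (wave 0 m) := by
  have : wave 0 m = fun x => Real.cos (freq m * x - phase m) := funext fun x => wave_zero m x
  rw [this]
  fun_prop

theorem periodic_wave (m : ℕ) : Periodic (wave 0 m) (2 * Real.pi) := fun x => by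
  rw [wave_zero, wave_zero, show (freq m : ℝ) * (x + 2 * Real.pi) - phase m =
    freq m * x - phase m + freq m * (2 * Real.pi) by ring, Real.cos_add_nat_mul_two_pi]

/-- `C^k(S)` as a space with continuous translations. -/
def translationSpace (k : ℕ) : TranslationSpace (Ck k) where
  ev := evalCLM
  ev_injective _ hF := ext_lift fun x => hF x
  continuous_ev F := F.contDiff_lift.continuous
  periodic_ev F := F.periodic_lift
  trans := translate
  continuous_trans := continuous_translate
  ev_trans _ _ _ := rfl
  trig m := mk (wave 0 m) (periodic_wave m) (contDiff_wave m)
  ev_trig _ _ := rfl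

end Ck

/-! ## The space `C^ω_δ(S)` -/

namespace Comega

variable {δ : ℝ≥0}

theorem norm_coe (F : Comega δ) : ‖F‖ = ‖(F.1 : Strip δ →ᵇ ℂ)‖ := rfl

theorem isOpen_strip (δ : ℝ≥0) : IsOpen {z : ℂ | |z.im| < δ} :=
  isOpen_lt Complex.continuous_im.abs continuous_const

/-- Holomorphy passes to uniform limits by Weierstrass' theorem; periodicity and reality pass to
pointwise limits. -/
theorem isClosed_comegaSubmodule : IsClosed (comegaSubmodule δ : Set (Strip δ →ᵇ ℂ)) := by
  refine IsSeqClosed.isClosed fun u F hu hF => ?_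
  have hunif := BoundedContinuousFunction.tendsto_iff_tendstoUniformly.1 hF
  have hpt : ∀ z, Tendsto (fun n => u n z) atTop (𝓝 (F z)) := fun z => hunif.tendsto_at z
  refine ⟨fun z w h => ?_, ?_, fun x => ?_⟩
  · exact tendsto_nhds_unique (hpt w) ((hpt z).congr fun n => ((hu n).1 z w h).symm)
  · choose G hG hGu using fun n => (hu n).2.1
    classical
    refine ⟨fun z => if h : |z.im| ≤ δ then F ⟨z, h⟩ else 0, ?_, fun z _ => by
      simp only [dif_pos z.2]⟩
    refine TendstoLocallyUniformlyOn.differentiableOn (F := G) (φ := atTop) ?_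
      (Eventually.of_forall hG) (isOpen_strip δ)
    refine TendstoUniformlyOn.tendstoLocallyUniformlyOn ?_
    rw [Metric.tendstoUniformlyOn_iff]
    intro ε hε
    filter_upwards [Metric.tendstoUniformly_iff.1 hunif ε hε] with n hn z hz
    have hz' : |z.im| ≤ δ := le_of_lt hz
    rw [dif_pos hz', ← hGu n ⟨z, hz'⟩ hz]
    exact hn _
  · have := (Complex.continuous_im.tendsto _).comp (hpt (Strip.ofReal x))
    exact tendsto_nhds_unique this (tendsto_const_nhds.congr fun n => ((hu n).2.2 x).symm)

instance : CompleteSpace (Comega δ) :=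
  (isClosed_comegaSubmodule (δ := δ)).completeSpace_coe

theorem continuous_ofReal : Continuous (Strip.ofReal : ℝ → Strip δ) :=
  Continuous.subtype_mk Complex.continuous_ofReal _

/-- Evaluation at a point of the line. -/
def evalCLM (x : ℝ) : Comega δ →L[ℝ] ℝ :=
  LinearMap.mkContinuous ⟨⟨fun F => F.lift x, fun _ _ => rfl⟩, fun c F => by
    change ((c • (F.1 : Strip δ →ᵇ ℂ)) (Strip.ofReal x)).re = c * F.lift x
    simp [lift]⟩ 1 fun F => by
    rw [one_mul]
    exact (Complex.abs_re_le_norm _).trans ((F.1 : Strip δ →ᵇ ℂ).norm_coe_le_norm _)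

/-- An element of `C^ω_δ(S)` is determined by its values on the line. -/
theorem eq_zero_of_lift (hδ : 0 < δ) (F : Comega δ) (h : ∀ x, F.lift x = 0) : F = 0 := by
  obtain ⟨G, hG, hFG⟩ := F.2.2.1
  have hreal : ∀ x : ℝ, F.1 (Strip.ofReal x) = 0 := fun x => Complex.ext (h x) (F.2.2.2 x)
  have hGreal : ∀ x : ℝ, G x = 0 := fun x => by
    rw [← hreal x]
    exact (hFG (Strip.ofReal x) (by simpa [Strip.ofReal] using hδ)).symm
  have hconv : IsPreconnected {z : ℂ | |z.im| < δ} := by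
    have : {z : ℂ | |z.im| < δ} = Complex.imLm ⁻¹' Set.Ioo (-(δ : ℝ)) δ := by
      ext z; simp [abs_lt]
    rw [this]
    exact ((convex_Ioo _ _).linear_preimage Complex.imLm).isPreconnected
  -- The zeros on the real line accumulate at `0`, so the identity theorem applies in the open
  -- strip.
  have hzero := (hG.analyticOnNhd (isOpen_strip δ)).eqOn_zero_of_preconnected_of_frequently_eq_zero
    hconv (z₀ := 0) (by simpa using hδ) (by
      have ht : Tendsto (fun x : ℝ => (x : ℂ)) (𝓝[≠] 0) (𝓝[≠] 0) := by
        refine tendsto_nhdsWithin_of_tendsto_nhds_of_eventually_within _ ?_ ?_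
        · exact (Complex.continuous_ofReal.tendsto' 0 0 (by simp)).mono_left nhdsWithin_le_nhds
        · filter_upwards [self_mem_nhdsWithin] with x hx
          simpa using hx
      exact ht.frequently (Frequently.of_forall hGreal))
  have hin : ∀ z : Strip δ, |(z : ℂ).im| < δ → F.1 z = 0 := fun z hz => by
    rw [hFG z hz]; exact hzero hz
  apply Subtype.ext
  ext z
  have hlt : ∀ n : ℕ, 1 - 1 / ((n : ℝ) + 1) < 1 ∧ 0 ≤ 1 - 1 / ((n : ℝ) + 1) := fun n => by
    have : 1 / ((n : ℝ) + 1) ≤ 1 := by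
      rw [div_le_one (by positivity)]
      linarith [(Nat.cast_nonneg n : (0 : ℝ) ≤ n)]
    have h2 : 0 < 1 / ((n : ℝ) + 1) := by positivity
    constructor <;> linarith
  have him : ∀ n : ℕ, |(((z : ℂ).re + ((1 - 1 / ((n : ℝ) + 1) : ℝ) * (z : ℂ).im : ℝ) *
      Complex.I : ℂ)).im| < δ := fun n => by
    simp only [Complex.add_im, Complex.ofReal_im, Complex.mul_im, Complex.ofReal_re, Complex.I_im,
      Complex.I_re, mul_one, mul_zero, zero_add, add_zero]
    rw [abs_mul, abs_of_nonneg (hlt n).2]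
    rcases (abs_nonneg (z : ℂ).im).eq_or_lt with h0 | h0
    · rw [← h0, mul_zero]; exact hδ
    · exact (mul_lt_of_lt_one_left h0 (hlt n).1).trans_le z.2
  -- Boundary points are reached vertically from inside the open strip, using continuity on the
  -- closed strip.
  set γ : ℕ → Strip δ := fun n => ⟨_, (him n).le⟩
  have hγ : Tendsto γ atTop (𝓝 z) := by
    rw [tendsto_subtype_rng]
    have h1 : Tendsto (fun n : ℕ => 1 - 1 / ((n : ℝ) + 1)) atTop (𝓝 (1 - 0)) :=
      tendsto_const_nhds.sub tendsto_one_div_add_atTop_nhds_zero_nat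
    have h2 : Continuous fun c : ℝ => ((z : ℂ).re + ((c * (z : ℂ).im : ℝ) : ℂ) * Complex.I : ℂ) := by
      fun_prop
    have h3 := (h2.tendsto (1 - 0)).comp h1
    have h4 : ((z : ℂ).re + (((1 - 0) * (z : ℂ).im : ℝ) : ℂ) * Complex.I : ℂ) = z := by
      rw [sub_zero, one_mul, Complex.re_add_im]
    rw [h4] at h3
    exact h3
  have h5 := ((F.1 : Strip δ →ᵇ ℂ).continuous.tendsto z).comp hγ
  exact tendsto_nhds_unique h5 (tendsto_const_nhds.congr fun n => (hin (γ n) (him n)).symm)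

/-- The horizontal translation of the strip. -/
def shift (s : ℝ) : C(Strip δ, Strip δ) :=
  ⟨fun z => ⟨z + s, by simpa using z.2⟩, by fun_prop⟩

theorem re_shift (s : ℝ) (z : Strip δ) : (shift s z : ℂ).re = (z : ℂ).re + s := by simp [shift]

/-- The translate of a function. -/
def translate (F : Comega δ) (s : ℝ) : Comega δ :=
  ⟨(F.1 : Strip δ →ᵇ ℂ).compContinuous (shift s), by
    refine ⟨fun z w h => F.2.1 _ _ ?_, ?_, fun x => ?_⟩
    · simp only [shift, ContinuousMap.coe_mk, h]; ring
    · obtain ⟨G, hG, hFG⟩ := F.2.2.1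
      refine ⟨fun z => G (z + s), hG.comp (by fun_prop) fun z hz => by simpa using hz,
        fun z hz => hFG _ (by simpa [shift] using hz)⟩
    · have : shift s (Strip.ofReal x : Strip δ) = Strip.ofReal (x + s) := by
        apply Subtype.ext; simp [shift, Strip.ofReal]
      rw [BoundedContinuousFunction.compContinuous_apply, this]
      exact F.2.2.2 _⟩

theorem translate_apply (F : Comega δ) (s : ℝ) (z : Strip δ) :
    (translate F s).1 z = F.1 (shift s z) := rfl

theorem lift_translate (F : Comega δ) (s x : ℝ) : (translate F s).lift x = F.lift (x + s) := by
  have : shift s (Strip.ofReal x : Strip δ) = Strip.ofReal (x + s) := by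
    apply Subtype.ext; simp [shift, Strip.ofReal]
  rw [lift, translate_apply, this, lift]

theorem apply_add_int_mul (F : Comega δ) (n : ℤ) (z : Strip δ) :
    F.1 (shift (n * (2 * Real.pi)) z) = F.1 z := by
  have hp : Periodic (fun s : ℝ => F.1 (shift s z)) (2 * Real.pi) := fun s =>
    F.2.1 _ _ (by simp [shift]; ring)
  have h1 := hp.int_mul n 0
  have h2 : shift 0 z = z := by apply Subtype.ext; simp [shift]
  simp only [zero_add, h2] at h1
  exact h1

theorem continuous_translate (F : Comega δ) : Continuous (translate F) := by
  rw [continuous_iff_continuousAt]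
  intro s₀
  rw [ContinuousAt, Metric.tendsto_nhds]
  intro ε hε
  set K : Set (Strip δ) := {z | (z : ℂ).re ∈ Set.Icc 0 (2 * Real.pi)}
  have hcl : IsClosed {z : ℂ | |z.im| ≤ δ} := isClosed_le Complex.continuous_im.abs continuous_const
  -- One period of the closed strip is compact, which gives uniformity of the estimate; periodicity
  -- extends it to the whole strip.
  have hK : IsCompact K := by
    have h1 : IsCompact (Set.Icc 0 (2 * Real.pi) ×ℂ Set.Icc (-(δ : ℝ)) δ) :=
      isCompact_Icc.reProdIm isCompact_Icc
    have h2 : K = Subtype.val ⁻¹' (Set.Icc 0 (2 * Real.pi) ×ℂ Set.Icc (-(δ : ℝ)) δ) := by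
      apply Set.ext
      intro z
      exact ⟨fun h => ⟨h, abs_le.1 z.2⟩, fun h => h.1⟩
    rw [h2]
    exact hcl.isClosedEmbedding_subtypeVal.isCompact_preimage h1
  have hev : ∀ᶠ s in 𝓝 s₀, ∀ z ∈ K, ‖F.1 (shift s z) - F.1 (shift s₀ z)‖ < ε / 2 := by
    refine hK.eventually_forall_of_forall_eventually fun z _ => ?_
    have hsh : Continuous fun y : ℝ × Strip δ => shift y.1 y.2 := by
      refine Continuous.subtype_mk ?_ _
      fun_prop
    have hcont : Continuous fun y : ℝ × Strip δ => ‖F.1 (shift y.1 y.2) - F.1 (shift s₀ y.2)‖ :=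
      (((F.1 : Strip δ →ᵇ ℂ).continuous.comp hsh).sub
        ((F.1 : Strip δ →ᵇ ℂ).continuous.comp ((shift s₀).continuous.comp continuous_snd))).norm
    exact hcont.continuousAt.eventually_lt continuousAt_const (by simpa using half_pos hε)
  filter_upwards [hev] with s hs
  rw [dist_eq_norm, norm_coe]
  refine lt_of_le_of_lt ((BoundedContinuousFunction.norm_le (half_pos hε).le).2 fun z => ?_)
    (half_lt_self hε)
  change ‖F.1 (shift s z) - F.1 (shift s₀ z)‖ ≤ ε / 2
  set n : ℤ := -toIcoDiv Real.two_pi_pos 0 (z : ℂ).re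
  have hcomm : ∀ t : ℝ, shift t (shift (n * (2 * Real.pi)) z) =
      shift (n * (2 * Real.pi)) (shift t z) := fun t => by
    apply Subtype.ext; simp [shift]; ring
  have hmem : shift (n * (2 * Real.pi)) z ∈ K := by
    have h1 := toIcoMod_mem_Ico Real.two_pi_pos 0 (z : ℂ).re
    rw [zero_add] at h1
    have h2 : (shift (n * (2 * Real.pi)) z : ℂ).re = toIcoMod Real.two_pi_pos 0 (z : ℂ).re := by
      rw [re_shift, ← self_sub_toIcoDiv_zsmul, zsmul_eq_mul, Int.cast_neg]
      ring
    rw [← h2] at h1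
    exact Set.Ico_subset_Icc_self h1
  have h3 := hs _ hmem
  rw [hcomm, hcomm, apply_add_int_mul, apply_add_int_mul] at h3
  exact h3.le

theorem norm_cos_le (w : ℂ) {C : ℝ} (hC : |w.im| ≤ C) : ‖Complex.cos w‖ ≤ Real.exp C := by
  have h1 : ‖Complex.exp (w * Complex.I)‖ ≤ Real.exp C := by
    rw [Complex.norm_exp]
    exact Real.exp_le_exp.2 (by simpa using (neg_le_abs w.im).trans hC)
  have h2 : ‖Complex.exp (-w * Complex.I)‖ ≤ Real.exp C := by
    rw [Complex.norm_exp]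
    exact Real.exp_le_exp.2 (by simpa using (le_abs_self w.im).trans hC)
  rw [Complex.cos, norm_div, Complex.norm_ofNat, div_le_iff₀ two_pos]
  exact (norm_add_le _ _).trans (by linarith)

/-- The trigonometric functions as elements of `C^ω_δ(S)`. -/
def trig (δ : ℝ≥0) (m : ℕ) : Comega δ :=
  ⟨BoundedContinuousFunction.ofNormedAddCommGroup
    (fun z : Strip δ => Complex.cos (freq m * z - phase m)) (by fun_prop) (Real.exp (freq m * δ))
    fun z => norm_cos_le _ (by
      simp only [Complex.sub_im, Complex.mul_im, Complex.natCast_re, Complex.natCast_im,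
        Complex.ofReal_im, zero_mul, add_zero, sub_zero, abs_mul, Nat.abs_cast]
      exact mul_le_mul_of_nonneg_left z.2 (Nat.cast_nonneg _)), by
    refine ⟨fun z w h => ?_, ⟨fun z => Complex.cos (freq m * z - phase m), by fun_prop,
      fun z _ => rfl⟩, fun x => ?_⟩
    · simp only [BoundedContinuousFunction.coe_ofNormedAddCommGroup, h]
      rw [show (freq m : ℂ) * (z + 2 * Real.pi) - phase m =
        freq m * z - phase m + freq m * (2 * Real.pi) by ring, Complex.cos_add_nat_mul_two_pi]
    · simp only [BoundedContinuousFunction.coe_ofNormedAddCommGroup, Strip.ofReal]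
      exact_mod_cast Complex.ofReal_im (Real.cos (freq m * x - phase m))⟩

theorem lift_trig (m : ℕ) (x : ℝ) : (trig δ m).lift x = wave 0 m x := by
  rw [wave_zero]
  change (Complex.cos (freq m * (x : ℂ) - phase m)).re = _
  exact_mod_cast Complex.ofReal_re (Real.cos (freq m * x - phase m))

/-- `C^ω_δ(S)` as a space with continuous translations. -/
def translationSpace (hδ : 0 < δ) : TranslationSpace (Comega δ) where
  ev := evalCLM
  ev_injective F hF := eq_zero_of_lift hδ F hF
  continuous_ev F :=
    Complex.continuous_re.comp ((F.1 : Strip δ →ᵇ ℂ).continuous.comp continuous_ofReal)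
  periodic_ev F := F.periodic_lift
  trans := translate
  continuous_trans := continuous_translate
  ev_trans F s x := lift_translate F s x
  trig := trig δ
  ev_trig := lift_trig

theorem toFun_coe (F : Comega δ) (x : ℝ) : F.toFun (x : Circle2Pi) = F.lift x :=
  (periodic_lift F).lift_coe x

end Comega

/-! ## The two parts of the theorem -/

theorem ck_lacunary_notMem_ICinf {k : ℕ} (F : Ck k) {w B t : ℕ → ℝ} (hw : IsWeight id w)
    (hB : IsRapid w B) (ht : ∀ m, |t m| ≤ 1) (hF : ∀ x, F.lift x = lacunary B id t 0 x) :
    F ∉ ICinf (Ck.toFun : Ck k → _) := by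
  rw [ICinf, Set.notMem_compl_iff, ICfin, Set.mem_iUnion₂]
  exact ⟨4, by norm_num, fun ρ => infinitesimalCyclicity_lacunary_le hw hB ht hF ρ⟩

/-- One sequence of rotation numbers `1 / j!`, with cyclicity at least `j`, excludes both sets: the
periods `j!` are arbitrarily large and the cyclicities unbounded. -/
theorem comega_lacunary_notMem {δ : ℝ≥0} (F : Comega δ) {w B t : ℕ → ℝ}
    (hw : IsWeight (fun j => j * j.factorial) w) (hB : IsRapid w B) (ht : ∀ m, |t m| ≤ 1)
    (hF : ∀ x, F.lift x = lacunary B (fun j => j * j.factorial) t 0 x) :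
    F ∉ ICess (Comega.toFun : Comega δ → _) 1 ∪ ICfin (Comega.toFun : Comega δ → _) := by
  have hlow : ∀ j : ℕ, (j : ℕ∞) ≤ infinitesimalCyclicity F.toFun (1 / j.factorial) :=
    le_infinitesimalCyclicity_lacunary (fun _ => rfl) hw hB ht fun x => by
      rw [Comega.toFun_coe, hF]
  rintro (⟨Q, hQ⟩ | h)
  -- The shift by `2` ensures a cyclicity of at least `2` even for `Q = 0`, while `(Q + 2)! ≥ Q`.
  · have h1 := hQ 1 (Q + 2).factorial ((Nat.le_add_right Q 2).trans (Nat.self_le_factorial _))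
      (Nat.factorial_pos _) (Nat.coprime_one_left _)
    rw [Nat.cast_one] at h1
    have h2 : Q + 2 ≤ 1 := by exact_mod_cast (hlow (Q + 2)).trans h1
    omega
  · rw [ICfin, Set.mem_iUnion₂] at h
    obtain ⟨N, -, hN⟩ := h
    have h2 : N + 1 ≤ N := by exact_mod_cast (hlow (N + 1)).trans (hN _)
    omega

end CircleFamily

end

theorem mainTheorem5 :
    (∀ k : ℕ, 2 ≤ k →
      ¬ CircleFamily.IsCubePrevalent
          (CircleFamily.ICinf (CircleFamily.Ck.toFun : CircleFamily.Ck k → _)) ∧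
      ∃ μ : MeasureTheory.Measure (CircleFamily.Ck k), CircleFamily.IsCubeMeasure μ ∧
        μ (CircleFamily.ICinf (CircleFamily.Ck.toFun : CircleFamily.Ck k → _)) = 0) ∧
    (∀ δ : NNReal, 0 < δ →
      ¬ CircleFamily.IsCubePrevalent
          (CircleFamily.ICess (CircleFamily.Comega.toFun : CircleFamily.Comega δ → _) 1) ∧
      ¬ CircleFamily.IsCubePrevalent
          (CircleFamily.ICfin (CircleFamily.Comega.toFun : CircleFamily.Comega δ → _)) ∧
      ∃ μ : MeasureTheory.Measure (CircleFamily.Comega δ), CircleFamily.IsCubeMeasure μ ∧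
        μ (CircleFamily.ICess (CircleFamily.Comega.toFun : CircleFamily.Comega δ → _) 1) = 0 ∧
        μ (CircleFamily.ICfin (CircleFamily.Comega.toFun : CircleFamily.Comega δ → _)) = 0) := by
  refine ⟨fun k _ => ?_, fun δ hδ => ?_⟩
  · obtain ⟨μ, hμ, h0, h1⟩ := (CircleFamily.Ck.translationSpace k).exists_isCubeMeasure id
      fun F w B t hw hB ht hF => CircleFamily.ck_lacunary_notMem_ICinf F hw hB ht hF
    exact ⟨fun h => h1 (h μ hμ), μ, hμ, h0⟩
  · obtain ⟨μ, hμ, h0, h1⟩ := (CircleFamily.Comega.translationSpace hδ).exists_isCubeMeasure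
      (fun j => j * j.factorial)
      fun F w B t hw hB ht hF => CircleFamily.comega_lacunary_notMem F hw hB ht hF
    exact ⟨fun h => h1 (measure_mono_null (Set.compl_subset_compl.2 Set.subset_union_left) (h μ hμ)),
      fun h => h1 (measure_mono_null (Set.compl_subset_compl.2 Set.subset_union_right) (h μ hμ)),
      μ, hμ, measure_mono_null Set.subset_union_left h0,
      measure_mono_null Set.subset_union_right h0⟩
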